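/- Let $\operatorname{k}$ be an algebraically closed field of characteristic zero, let $N$ be a lattice of rank $n$ with dual lattice $M=\operatorname{Hom}(N,\mathbb Z)$, and let $\Sigma$ be a smooth fan in $N_{\mathbb R}$ (each cone is generated by a part of a $\mathbb Z$-basis of $N$) whose rays $\Sigma(1)$ span $N_{\mathbb R}$. Let $X$ be the smooth toric variety of $\Sigma$ over $\operatorname{k}$, with function field $K$, characters $x^m\in K$ ($m\in M$), affine charts $U_\sigma=\operatorname{Spec}\operatorname{k}[\sigma^\vee\cap M]$ ($\sigma\in\Sigma$) and torus invariant prime divisors $D_\rho$ ($\rho\in\Sigma(1)$). Write $\Sigma(n)$ for the set of $n$-dimensional cones and $\sigma(1)$ for the set of rays of a cone $\sigma$; rays are identified with their primitive generators. For $\sigma\in\Sigma(n)$ the set $\sigma(1)$ is a $\mathbb Z$-basis of $N$; for $\rho\in\sigma(1)$ let $\hat\rho_\sigma\in M$ be the element of the dual basis with $\langle\hat\rho_\sigma,\rho\rangle=1$. For a prime divisor $P$ let $\operatorname{ord}_P$ be its valuation on $K$, with $\operatorname{ord}_P(0)=\infty$ (so $\operatorname{div}(0)=\infty$). The generic stalk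 $\operatorname{Der}_{\operatorname{k}}(K,K)$ of the tangent sheaf $\mathcal T_X$ is identified with $N_K=N\otimes_{\mathbb Z}K$: an element $a\in N_K$ is the derivation with $x^m\mapsto\langle m,a\rangle x^m$ for $m\in M$. The Weil decoration $\mathcal W_{\mathcal T_X}$ of $\mathcal T_X$ assigns $\infty$ to $0$ and, to $0\ne a\in N_K$, the Weil divisor $D$ with $\mathcal O_X(D)\cdot a=(K\cdot a)\cap\mathcal T_X$ as subsheaves of the constant sheaf $N_K$, where $\mathcal O_X(D)(U)=\{f\in K\mid (D+\operatorname{div}(f))|_U\ge0\}$. Then $\mathcal W_{\mathcal T_X}$ exists and is unique, and the following holds for every $a\in N_K$. (1) If every ray of $\Sigma$ is contained in some cone of $\Sigma(n)$, then $$\mathcal W_{\mathcal T_X}(a)=\bigwedge_{\sigma\in\Sigma(n),\,\rho\in\sigma(1)}\Big(\operatorname{div}\langle\hat\rho_\sigma,a\rangle+D_\rho+\sum_{\rho'\in\Sigma(1)\setminus\sigma(1)}D_{\rho'}\Big),$$ where $\bigwedge$ denotes the coefficientwise minimum. (2) For every $\sigma\in\Sigma(n)$ and every prime divisor $P$ of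 $X$ meeting $U_\sigma$ (that is, whose generic point lies in $U_\sigma$), the coefficient of $\mathcal W_{\mathcal T_X}(a)$ at $P$ is $$\mathcal W_{\mathcal T_X}(a)_P=\min_{\rho\in\sigma(1)}\big(\operatorname{ord}_P\langle\hat\rho_\sigma,a\rangle+\delta_{D_\rho,P}\big),$$ where $\delta_{D_\rho,P}=1$ if $P=D_\rho$ and $0$ otherwise. -/

import Mathlib

universe u

open CategoryTheory CategoryTheory.Limits AlgebraicGeometry TensorProduct

namespace Toric

section
variable (X : Scheme.{u})
/-- A prime divisor of `X`, given by its generic point: a point of codimension one. -/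
abbrev PrimeDivisor : Type u := {P : X // Order.coheight P = 1}

/-- The group `Div(X)` of Weil divisors on the Noetherian scheme `X`: the free abelian group on the
prime divisors. -/
abbrev Divisor : Type u := PrimeDivisor X →₀ ℤ

/-- Families of coefficients in `ℤ ∪ {∞}` indexed by the prime divisors, ordered coefficientwise.
The infimum of such families is the meet of divisors; the constant family `⊤` is the formal value
`∞` of `div 0` and of a Weil decoration at `0`. -/
abbrev ExtDivisor : Type u := PrimeDivisor X → WithTop ℤ

variable {X}
/-- A Weil divisor as a family of coefficients. -/
noncomputable def Divisor.toExt (D : Divisor X) : ExtDivisor X := fun P => (D P : WithTop ℤ)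

variable [IsIntegral X] [IsLocallyNoetherian X]

open scoped Classical in
/-- The divisor `div f` of a rational function, with `ord_P 0 = ∞`. -/
noncomputable def principalDivisor (f : X.functionField) : ExtDivisor X :=
  fun P => if f = 0 then ⊤ else (Scheme.ord f P.1 : ℤ)

/-- The sections over `U` of the divisorial sheaf `𝒪_X(D)` inside the function field:
the rational functions `f` with `(D + div f)|_U ≥ 0`, including `f = 0`. -/
def divisorialSheaf (D : Divisor X) (U : X.Opens) : Set X.functionField :=
  {f | ∀ P : PrimeDivisor X, P.1 ∈ U → 0 ≤ (D.toExt + principalDivisor f) P}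

/-- Let `E` be a subsheaf of the constant sheaf `V`, given by its sections `E U ⊆ V`, where `V` is the
generic stalk. `W` is the Weil decoration of `E` if `W 0 = ∞` and if, for `e ≠ 0`, `W e` is the Weil
divisor `D` with `𝒪_X(D) · e = (K · e) ∩ E`, i.e. `f ∈ 𝒪_X(D)(U)` iff `f • e ∈ E(U)` for all
nonempty open `U` and all `f ∈ K`. -/
structure IsWeilDecoration {V : Type u} [AddCommGroup V] [Module X.functionField V]
    (E : X.Opens → AddSubgroup V) (W : V → ExtDivisor X) : Prop where
  map_zero : W 0 = ⊤
  map_ne_zero : ∀ e : V, e ≠ 0 → ∃ D : Divisor X, W e = D.toExt ∧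
    ∀ U : X.Opens, (U : Set X).Nonempty → ∀ f : X.functionField,
      f ∈ divisorialSheaf D U ↔ f • e ∈ E U

/-- The tangent sheaf `𝒯_X = Der_k(𝒪_X, 𝒪_X)` as a subsheaf of its generic stalk `Der_k(K, K)`,
`K = K(X)`. As `X` is integral, a derivation of the sheaf `𝒪_X|_U` is the same thing as a derivation
of `K` that maps `𝒪_X(V) ⊆ K` into itself for every nonempty open `V ⊆ U`. -/
def tangentSheaf (k : Type u) [Field k] (X : Scheme.{u}) [IsIntegral X]
    [Algebra k X.functionField] (U : X.Opens) :
    AddSubgroup (Derivation k X.functionField X.functionField) where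
  carrier := {δ | ∀ (V : X.Opens) [Nonempty V], V ≤ U → ∀ g : Γ(X, V), ∃ h : Γ(X, V),
    δ (X.germToFunctionField V g) = X.germToFunctionField V h}
  zero_mem' V _ _ g := ⟨0, by simp⟩
  add_mem' {δ δ'} hδ hδ' V _ hV g := by
    obtain ⟨h, hh⟩ := hδ V hV g
    obtain ⟨h', hh'⟩ := hδ' V hV g
    exact ⟨h + h', by simp [hh, hh']⟩
  neg_mem' {δ} hδ V _ hV g := by
    obtain ⟨h, hh⟩ := hδ V hV g
    exact ⟨-h, by simp [hh]⟩
end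

section
variable {k A K : Type u} [Field k] [CommRing A] [Field K] [Algebra k A] [Algebra A K] [Algebra k K]
  [IsScalarTower k A K] [IsFractionRing A K]

/-- The unique extension of a derivation `A → K` to the fraction field `K` of `A`. -/
noncomputable def extendDerivation (d : Derivation k A K) : Derivation k K K :=
  have : Algebra.FormallyEtale A K := Algebra.FormallyEtale.of_isLocalization (nonZeroDivisors A)
  ((LinearMap.liftBaseChange K d.liftKaehlerDifferential).comp
    (KaehlerDifferential.tensorKaehlerEquivOfFormallyEtale k A K).symm.toLinearMap).compDer
    (KaehlerDifferential.D k K)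

lemma extendDerivation_algebraMap (d : Derivation k A K) (x : A) :
    extendDerivation d (algebraMap A K x) = d x := by
  simp [extendDerivation, KaehlerDifferential.tensorKaehlerEquivOfFormallyEtale_symm_D_algebraMap]
end

section
variable {k K S : Type u} [Field k] [AddCommMonoid S] [Field K] [Algebra (AddMonoidAlgebra k S) K] [Algebra k K]
  [IsScalarTower k (AddMonoidAlgebra k S) K]

/-- The `k`-linear map `k[S] → K` with `x^m ↦ g(m) x^m`. -/
noncomputable def weightLinear (g : S →+ K) : AddMonoidAlgebra k S →ₗ[k] K :=
  (Finsupp.lsum k fun m => LinearMap.toSpanSingleton k K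
    (g m * algebraMap (AddMonoidAlgebra k S) K (AddMonoidAlgebra.single m 1))).comp
      (AddMonoidAlgebra.coeffLinearEquiv k).toLinearMap

lemma weightLinear_single (g : S →+ K) (m : S) (c : k) :
    weightLinear g (AddMonoidAlgebra.single m c) =
      g m * algebraMap (AddMonoidAlgebra k S) K (AddMonoidAlgebra.single m c) := by
  have h : algebraMap (AddMonoidAlgebra k S) K (AddMonoidAlgebra.single m c) =
      algebraMap k K c * algebraMap (AddMonoidAlgebra k S) K (AddMonoidAlgebra.single m 1) := by
    rw [IsScalarTower.algebraMap_apply k (AddMonoidAlgebra k S) K, ← map_mul]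
    simp [AddMonoidAlgebra.single_mul_single]
  have h' : weightLinear g (AddMonoidAlgebra.single m c) = algebraMap k K c *
      (g m * algebraMap (AddMonoidAlgebra k S) K (AddMonoidAlgebra.single m 1)) := by
    simp [weightLinear, AddMonoidAlgebra.coeffLinearEquiv, Algebra.smul_def]
  rw [h', h]
  ring

/-- The `k`-derivation `k[S] → K` with `x^m ↦ g(m) x^m`. -/
noncomputable def weightDerivation (g : S →+ K) : Derivation k (AddMonoidAlgebra k S) K :=
  Derivation.mk' (weightLinear g) (by
    intro a b
    induction a using AddMonoidAlgebra.induction_linear with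
    | zero => simp
    | add a a' ha ha' =>
      rw [add_mul, map_add, ha, ha', map_add, smul_add, add_smul]
      abel
    | single m c =>
      induction b using AddMonoidAlgebra.induction_linear with
      | zero => simp
      | add b b' hb hb' =>
        rw [mul_add, map_add, hb, hb', map_add, smul_add, add_smul]
        abel
      | single m' c' =>
        rw [AddMonoidAlgebra.single_mul_single, weightLinear_single, weightLinear_single,
          weightLinear_single, ← AddMonoidAlgebra.single_mul_single, map_mul, map_add,
          Algebra.smul_def, Algebra.smul_def]
        ring)

lemma weightDerivation_single (g : S →+ K) (m : S) (c : k) :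
    weightDerivation g (AddMonoidAlgebra.single m c) =
      g m * algebraMap (AddMonoidAlgebra k S) K (AddMonoidAlgebra.single m c) :=
  weightLinear_single g m c
end

section Fans

variable {N : Type u} [AddCommGroup N]

/-- The character lattice `M`, dual to `N`, with pairing `⟨m, v⟩ = m v`. -/
abbrev CharLattice (N : Type u) [AddCommGroup N] : Type u := N →ₗ[ℤ] ℤ

/-- The cone in `N_ℝ = ℝ ⊗ N` generated by a set of lattice vectors. -/
noncomputable def realCone (s : Set N) : PointedCone ℝ (ℝ ⊗[ℤ] N) :=
  PointedCone.hull ℝ ((fun v : N => (1 : ℝ) ⊗ₜ[ℤ] v) '' s)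

/-- The vectors in `s` form a part of some `ℤ`-basis of the lattice `N`. -/
def IsPartOfBasis (s : Finset N) : Prop :=
  ∃ b : Module.Basis (Fin (Module.finrank ℤ N)) ℤ N, (s : Set N) ⊆ Set.range b

variable (N) in
/-- A smooth (finite) fan in `N_ℝ`. A cone `σ` of a smooth fan is generated by a part of a `ℤ`-basis
of `N`, and this part is the set of primitive generators of the rays of `σ`; so `σ` is recorded by
this finite set, also denoted `σ(1)`. The dimension of the cone is the number of its generators, and
its faces are the cones generated by the subsets of `σ(1)`. -/
structure SmoothFan where
  /-- The cones, each given by its set of primitive ray generators. -/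
  cones : Finset (Finset N)
  nonempty : cones.Nonempty
  /-- Every cone is smooth. -/
  smooth : ∀ σ ∈ cones, IsPartOfBasis σ
  /-- Every face of a cone of the fan is in the fan. -/
  face_mem : ∀ σ ∈ cones, ∀ τ ⊆ σ, τ ∈ cones
  /-- Two cones of the fan intersect in a common face. -/
  inter : ∀ σ ∈ cones, ∀ τ ∈ cones,
    realCone (σ : Set N) ⊓ realCone (τ : Set N) = realCone ((σ : Set N) ∩ (τ : Set N))

/-- The monoid `σ^∨ ∩ M`. -/
def dualMonoid (σ : Finset N) : AddSubmonoid (CharLattice N) where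
  carrier := {m | ∀ v ∈ σ, 0 ≤ m v}
  zero_mem' := by simp
  add_mem' := fun {a b} ha hb v hv => by
    simpa using add_nonneg (ha v hv) (hb v hv)

lemma dualMonoid_anti {σ τ : Finset N} (h : τ ⊆ σ) : dualMonoid σ ≤ dualMonoid τ :=
  fun _ hm v hv => hm v (h hv)

lemma dualMonoid_fg {σ : Finset N} (h : IsPartOfBasis σ) : AddMonoid.FG (dualMonoid σ) := by
  classical
  obtain ⟨b, hb⟩ := h
  rw [AddMonoid.fg_iff_addSubmonoid_fg]
  refine ⟨(Finset.univ.image fun i => b.coord i) ∪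
    ((Finset.univ.filter fun i => b i ∉ σ).image fun i => -b.coord i), ?_⟩
  apply le_antisymm
  · rw [AddSubmonoid.closure_le]
    intro m hm v hv
    obtain ⟨j, rfl⟩ := hb hv
    simp only [Finset.coe_union, Finset.coe_image, Finset.coe_univ, Set.image_univ,
      Finset.coe_filter, Set.mem_union, Set.mem_range, Set.mem_image, Set.mem_ofPred_eq,
      Finset.mem_univ, true_and] at hm
    rcases hm with ⟨i, rfl⟩ | ⟨i, hi, rfl⟩
    · by_cases hij : j = i <;> simp [hij]
    · have hij : j ≠ i := by rintro rfl; exact hi hv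
      simp [hij]
  · intro m hm
    have : m = ∑ i, m (b i) • b.coord i := by
      apply b.ext
      intro j
      simp [Finsupp.single_apply]
    rw [this]
    refine AddSubmonoid.sum_mem _ fun i _ => ?_
    by_cases hi : b i ∈ σ
    · obtain ⟨n, hn⟩ := Int.eq_ofNat_of_zero_le (hm _ hi)
      rw [hn, natCast_zsmul]
      exact AddSubmonoid.nsmul_mem _ (AddSubmonoid.subset_closure (by simp)) _
    · rcases Int.eq_nat_or_neg (m (b i)) with ⟨n, hn | hn⟩
      · rw [hn, natCast_zsmul]
        exact AddSubmonoid.nsmul_mem _ (AddSubmonoid.subset_closure (by simp)) _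
      · rw [hn, neg_smul, natCast_zsmul, ← smul_neg]
        refine AddSubmonoid.nsmul_mem _ (AddSubmonoid.subset_closure ?_) _
        simp only [Finset.coe_union, Set.mem_union, Finset.coe_image]
        right
        exact ⟨i, by simpa using hi, rfl⟩

/-- The coordinate ring `k[σ^∨ ∩ M]` of the affine toric variety `U_σ`. -/
abbrev CoordRing (k : Type u) [Field k] (σ : Finset N) : Type u :=
  AddMonoidAlgebra k (dualMonoid σ)

section
variable (k : Type u) [Field k]

/-- The inclusion `k[σ^∨ ∩ M] ⊆ k[τ^∨ ∩ M]` for a face `τ` of `σ`. -/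
noncomputable def coordRingMap {σ τ : Finset N} (h : τ ⊆ σ) :
    CoordRing k σ →+* CoordRing k τ :=
  AddMonoidAlgebra.mapDomainRingHom k (AddSubmonoid.inclusion (dualMonoid_anti h))

/-- The monomial `x^m`. -/
noncomputable def chi {σ : Finset N} (m : dualMonoid σ) : CoordRing k σ :=
  AddMonoidAlgebra.single m 1

lemma coordRing_isDomain {σ : Finset N} (h : IsPartOfBasis σ) : IsDomain (CoordRing k σ) := by
  obtain ⟨b, -⟩ := h
  let f : dualMonoid σ →ₙ+ (Fin (Module.finrank ℤ N) → ℤ) :=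
    { toFun := fun m i => m.1 (b i)
      map_add' := fun _ _ => rfl }
  have : TwoUniqueSums (dualMonoid σ) :=
    .of_injective_addHom f (fun m m' hmm => Subtype.ext (b.ext fun i => congrFun hmm i))
      inferInstance
  infer_instance

lemma coordRing_isNoetherian {σ : Finset N} (h : IsPartOfBasis σ) :
    IsNoetherianRing (CoordRing k σ) := by
  have := dualMonoid_fg h
  have : Algebra.FiniteType k (CoordRing k σ) := inferInstance
  exact Algebra.FiniteType.isNoetherianRing k _

lemma coordRingMap_chi {σ τ : Finset N} (h : τ ⊆ σ) (m : dualMonoid σ) :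
    coordRingMap k h (chi k m) = chi k ⟨m.1, dualMonoid_anti h m.2⟩ := by
  simp only [coordRingMap, chi, AddMonoidAlgebra.mapDomainRingHom_apply, AddMonoidAlgebra.mapDomain_single]
  rfl

lemma chi_pow {σ : Finset N} (m : dualMonoid σ) (n : ℕ) : chi k m ^ n = chi k (n • m) := by
  simp [chi, AddMonoidAlgebra.single_pow]

lemma chi_mul {σ : Finset N} (m m' : dualMonoid σ) : chi k m * chi k m' = chi k (m + m') := by
  simp [chi, AddMonoidAlgebra.single_mul_single]

lemma coordRingMap_injective {σ τ : Finset N} (h : τ ⊆ σ) :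
    Function.Injective (coordRingMap k h) :=
  AddMonoidAlgebra.mapDomain_injective (AddSubmonoid.inclusion_injective _)

lemma coordRing_away {σ τ : Finset N} (h : τ ⊆ σ) (m : dualMonoid σ)
    (hm : ∀ v ∈ σ, m.1 v = 0 ↔ v ∈ τ) :
    let _ := (coordRingMap k h).toAlgebra
    IsLocalization.Away (chi k m) (CoordRing k τ) := by
  let _ := (coordRingMap k h).toAlgebra
  have hneg : -m.1 ∈ dualMonoid τ := fun v hv => by simp [(hm v (h hv)).2 hv]
  have hmt := dualMonoid_anti h m.2
  have hmul : (chi k ⟨m.1, hmt⟩ : CoordRing k τ) * chi k ⟨-m.1, hneg⟩ = 1 := by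
    rw [chi_mul, AddMonoidAlgebra.one_def, chi]
    congr 1
    ext1
    simp
  refine IsLocalization.Away.mk _ ?_ ?_ ?_
  · rw [RingHom.algebraMap_toAlgebra, coordRingMap_chi]
    exact IsUnit.of_mul_eq_one _ hmul
  · intro s
    rw [RingHom.algebraMap_toAlgebra, coordRingMap_chi]
    induction s using AddMonoidAlgebra.induction_linear with
    | zero => exact ⟨0, 0, by simp⟩
    | add f g hf hg =>
      obtain ⟨n, a, ha⟩ := hf
      obtain ⟨n', a', ha'⟩ := hg
      refine ⟨n + n', a * chi k m ^ n' + a' * chi k m ^ n, ?_⟩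
      rw [map_add, map_mul, map_mul, map_pow, map_pow, coordRingMap_chi, ← ha, ← ha']
      ring
    | single m' c =>
      let n : ℕ := ∑ v ∈ σ, (m'.1 v).natAbs
      have hmem : m'.1 + n • m.1 ∈ dualMonoid σ := by
        intro v hv
        have h0 : 0 ≤ m.1 v := m.2 v hv
        simp only [LinearMap.add_apply, LinearMap.smul_apply, nsmul_eq_mul]
        by_cases hvt : v ∈ τ
        · have := m'.2 v hvt
          positivity
        · have h1 : 1 ≤ m.1 v := by
            have : m.1 v ≠ 0 := fun h => hvt ((hm v hv).1 h)
            omega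
          have h2 : (m'.1 v).natAbs ≤ n :=
            Finset.single_le_sum (f := fun v => (m'.1 v).natAbs) (fun _ _ => Nat.zero_le _) hv
          have h3 : ((m'.1 v).natAbs : ℤ) ≤ n := by exact_mod_cast h2
          have h4 : (n : ℤ) ≤ n * m.1 v := le_mul_of_one_le_right (by positivity) h1
          omega
      refine ⟨n, AddMonoidAlgebra.single ⟨_, hmem⟩ c, ?_⟩
      rw [chi_pow, chi, AddMonoidAlgebra.single_mul_single, mul_one]
      simp only [coordRingMap, AddMonoidAlgebra.mapDomainRingHom_apply,
        AddMonoidAlgebra.mapDomain_single]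
      rfl
  · intro a b hab
    exact ⟨0, by rw [coordRingMap_injective k h hab]⟩
end

variable (k : Type u) [Field k] (F : SmoothFan N)

/-- The cones of the fan, ordered by inclusion. -/
abbrev SmoothFan.Cone : Type u := {σ : Finset N // σ ∈ F.cones}

/-- The diagram of the affine toric varieties `U_σ = Spec k[σ^∨ ∩ M]` and their face inclusions. -/
noncomputable def SmoothFan.diagram : F.Cone ⥤ Scheme.{u} where
  obj σ := Spec (.of (CoordRing k σ.1))
  map {τ σ} f := Spec.map (CommRingCat.ofHom (coordRingMap k (leOfHom f)))
  map_id σ := by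
    rw [← Spec.map_id, ← CommRingCat.ofHom_id]
    congr 2
    exact AddMonoidAlgebra.mapDomainRingHom_id
  map_comp {τ σ ρ} f g := by
    rw [← Spec.map_comp, ← CommRingCat.ofHom_comp]
    congr 2
    exact AddMonoidAlgebra.mapDomainRingHom_comp
      (AddSubmonoid.inclusion (dualMonoid_anti (leOfHom f)))
      (AddSubmonoid.inclusion (dualMonoid_anti (leOfHom g)))

lemma exists_face_equation {σ τ : Finset N} (hσ : IsPartOfBasis σ) (_ : τ ⊆ σ) :
    ∃ m : dualMonoid σ, ∀ v ∈ σ, m.1 v = 0 ↔ v ∈ τ := by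
  classical
  obtain ⟨b, hb⟩ := hσ
  have key : ∀ j, (∑ i with b i ∉ τ, b.coord i) (b j) = if b j ∈ τ then 0 else 1 := by
    intro j
    simp [Finsupp.single_apply, Finset.sum_ite_eq]
  refine ⟨⟨∑ i with b i ∉ τ, b.coord i, ?_⟩, ?_⟩
  · intro v hv
    obtain ⟨j, rfl⟩ := hb hv
    rw [key]
    split_ifs <;> simp
  · intro v hv
    obtain ⟨j, rfl⟩ := hb hv
    simp only
    rw [key]
    simp

lemma diagram_map_isOpenImmersion_range {τ σ : F.Cone} (f : τ ⟶ σ) (m : dualMonoid σ.1)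
    (hm : ∀ v ∈ σ.1, m.1 v = 0 ↔ v ∈ τ.1) :
    IsOpenImmersion ((F.diagram k).map f) ∧ Set.range ((F.diagram k).map f) =
      (PrimeSpectrum.basicOpen (chi k m) : Set (PrimeSpectrum (CoordRing k σ.1))) := by
  let _ := (coordRingMap k (leOfHom f)).toAlgebra
  have := coordRing_away k (leOfHom f) m hm
  exact ⟨IsOpenImmersion.of_isLocalization (chi k m),
    PrimeSpectrum.localization_away_comap_range _ (chi k m)⟩

instance {τ σ : F.Cone} (f : τ ⟶ σ) : IsOpenImmersion ((F.diagram k).map f) := by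
  obtain ⟨m, hm⟩ := exists_face_equation (F.smooth _ σ.2) (leOfHom f)
  exact (diagram_map_isOpenImmersion_range k F f m hm).1

instance : (F.diagram k ⋙ Scheme.forget).IsLocallyDirected where
  cond {i j σ} fi fj xi xj hx := by
    classical
    obtain ⟨mi, hmi⟩ := exists_face_equation (F.smooth _ σ.2) (leOfHom fi)
    obtain ⟨mj, hmj⟩ := exists_face_equation (F.smooth _ σ.2) (leOfHom fj)
    replace hx : (F.diagram k).map fi xi = (F.diagram k).map fj xj := hx
    let l : F.Cone := ⟨i.1 ∩ j.1, F.face_mem _ i.2 _ Finset.inter_subset_left⟩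
    let fli : l ⟶ i := homOfLE (Finset.inter_subset_left : i.1 ∩ j.1 ⊆ i.1)
    let flj : l ⟶ j := homOfLE (Finset.inter_subset_right : i.1 ∩ j.1 ⊆ j.1)
    have hm : ∀ v ∈ σ.1, (mi + mj).1 v = 0 ↔ v ∈ l.1 := by
      intro v hv
      have h1 := mi.2 v hv
      have h2 := mj.2 v hv
      rw [Finset.mem_inter, ← hmi v hv, ← hmj v hv]
      simp only [AddSubmonoid.coe_add, LinearMap.add_apply]
      omega
    have hl := (diagram_map_isOpenImmersion_range k F (fli ≫ fi) (mi + mj) hm).2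
    have hi := (diagram_map_isOpenImmersion_range k F fi mi hmi).2
    have hj := (diagram_map_isOpenImmersion_range k F fj mj hmj).2
    have h1 : (F.diagram k).map fi xi ∈ Set.range ((F.diagram k).map (fli ≫ fi)) := by
      rw [hl, ← chi_mul, PrimeSpectrum.basicOpen_mul]
      refine ⟨?_, ?_⟩
      · have : (F.diagram k).map fi xi ∈ Set.range ((F.diagram k).map fi) := ⟨_, rfl⟩
        rwa [hi] at this
      · have : (F.diagram k).map fi xi ∈ Set.range ((F.diagram k).map fj) := ⟨xj, hx.symm⟩
        rwa [hj] at this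
    obtain ⟨x, hx'⟩ := h1
    refine ⟨l, fli, flj, x, ?_, ?_⟩
    · apply ((F.diagram k).map fi).isOpenEmbedding.injective
      rw [Functor.map_comp] at hx'
      exact hx'
    · apply ((F.diagram k).map fj).isOpenEmbedding.injective
      have h2 : fli ≫ fi = flj ≫ fj := Subsingleton.elim _ _
      rw [h2, Functor.map_comp] at hx'
      exact hx'.trans hx

/-- The toric variety of the fan, glued from the `U_σ` along the face inclusions. -/
noncomputable def SmoothFan.toricVariety : Scheme.{u} := colimit (F.diagram k)

/-- The open immersion of `U_σ` into the toric variety. -/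
noncomputable def SmoothFan.chart (σ : F.Cone) :
    Spec (.of (CoordRing k σ.1)) ⟶ F.toricVariety k :=
  colimit.ι (F.diagram k) σ

instance (σ : F.Cone) : IsOpenImmersion (F.chart k σ) :=
  inferInstanceAs (IsOpenImmersion (colimit.ι (F.diagram k) σ))

/-- The zero cone; its chart is the torus `T = Spec k[M]`. -/
def SmoothFan.zeroCone : F.Cone :=
  ⟨∅, F.face_mem _ F.nonempty.choose_spec _ (Finset.empty_subset _)⟩

/-- The open cover by the affine toric varieties `U_σ`. -/
noncomputable def SmoothFan.charts : (F.toricVariety k).OpenCover :=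
  Scheme.IsLocallyDirected.openCover (F.diagram k)

/-- The structure morphism of the toric variety. -/
noncomputable def SmoothFan.structureMorphism : F.toricVariety k ⟶ Spec (.of k) :=
  colimit.desc (F.diagram k)
    { pt := Spec (.of k)
      ι :=
        { app := fun σ => Spec.map (CommRingCat.ofHom (algebraMap k (CoordRing k σ.1)))
          naturality := fun τ σ f => by
            simp only [SmoothFan.diagram, Functor.const_obj_obj, Functor.const_obj_map,
              Category.comp_id]
            rw [← Spec.map_comp, ← CommRingCat.ofHom_comp]
            congr 2
            exact AddMonoidAlgebra.mapDomainRingHom_comp_algebraMap _ } }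

lemma chart_structureMorphism (σ : F.Cone) : F.chart k σ ≫ F.structureMorphism k =
    Spec.map (CommRingCat.ofHom (algebraMap k (CoordRing k σ.1))) :=
  colimit.ι_desc _ _

instance (σ : F.Cone) : IsDomain (CoordRing k σ.1) := coordRing_isDomain k (F.smooth _ σ.2)

instance (σ : F.Cone) : IsNoetherianRing (CoordRing k σ.1) :=
  coordRing_isNoetherian k (F.smooth _ σ.2)

instance : IsReduced (F.toricVariety k) := by
  have : ∀ i, IsReduced ((F.charts k).X i) := fun (σ : F.Cone) =>
    inferInstanceAs (IsReduced (Spec (.of (CoordRing k σ.1))))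
  exact IsReduced.of_openCover _ (F.charts k)

instance : IsLocallyNoetherian (F.toricVariety k) :=
  (isLocallyNoetherian_iff_openCover (F.charts k)).2 fun (σ : F.Cone) =>
    inferInstanceAs (IsLocallyNoetherian (Spec (.of (CoordRing k σ.1))))

lemma chart_zeroCone_range (σ : F.Cone) :
    Set.range (F.chart k F.zeroCone) ⊆ Set.range (F.chart k σ) := by
  let f : F.zeroCone ⟶ σ := homOfLE (Finset.empty_subset σ.1)
  have h : (F.diagram k).map f ≫ F.chart k σ = F.chart k F.zeroCone := colimit.w _ f
  rintro _ ⟨y, rfl⟩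
  refine ⟨(F.diagram k).map f y, ?_⟩
  rw [← h]
  rfl

instance : IrreducibleSpace (F.toricVariety k) := by
  have hirr : ∀ σ, IsIrreducible (Set.range (F.chart k σ)) := fun σ => by
    rw [← Set.image_univ]
    exact (IrreducibleSpace.isIrreducible_univ _).image _ (F.chart k σ).continuous.continuousOn
  have hT : IsOpen (Set.range (F.chart k F.zeroCone)) :=
    (F.chart k F.zeroCone).isOpenEmbedding.isOpen_range
  have hmeet : ∀ U : Set (F.toricVariety k), IsOpen U → U.Nonempty →
      (Set.range (F.chart k F.zeroCone) ∩ U).Nonempty := by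
    rintro U hU ⟨x, hx⟩
    obtain ⟨σ, y, rfl⟩ := Scheme.IsLocallyDirected.ι_jointly_surjective (F.diagram k) x
    obtain ⟨z, hz, hz'⟩ := (hirr σ).2 _ U hT hU (by
      obtain ⟨t, ht⟩ := (hirr F.zeroCone).1
      exact ⟨t, chart_zeroCone_range k F σ ht, ht⟩) ⟨_, ⟨y, rfl⟩, hx⟩
    exact ⟨z, hz'⟩
  have : PreirreducibleSpace (F.toricVariety k) := ⟨fun U V hU hV ⟨x, _, hx⟩ ⟨y, _, hy⟩ => by
    obtain ⟨z, _, hz⟩ := (hirr F.zeroCone).2 U V hU hV (hmeet U hU ⟨x, hx⟩) (hmeet V hV ⟨y, hy⟩)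
    exact ⟨z, trivial, hz⟩⟩
  exact ⟨(hirr F.zeroCone).1.to_type⟩

instance : IsIntegral (F.toricVariety k) := isIntegral_of_irreducibleSpace_of_isReduced _


/-- The function field is a `k`-algebra via the structure morphism. -/
noncomputable instance : Algebra k (F.toricVariety k).functionField :=
  ((Scheme.ΓSpecIso (.of k)).inv ≫ (F.structureMorphism k).appTop ≫
    (F.toricVariety k).presheaf.germ ⊤ (genericPoint (F.toricVariety k)) trivial).hom.toAlgebra

/-- `U_σ` as an open subset of the toric variety. -/
noncomputable def SmoothFan.affineOpen (σ : F.Cone) : (F.toricVariety k).Opens :=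
  (F.chart k σ) ''ᵁ ⊤

instance (σ : F.Cone) : Nonempty (F.affineOpen k σ) := by
  obtain ⟨x⟩ := (inferInstance : Nonempty (Spec (.of (CoordRing k σ.1))))
  exact ⟨⟨F.chart k σ x, x, trivial, rfl⟩⟩

/-- The embedding `k[σ^∨ ∩ M] = 𝒪(U_σ) → K(X)`. -/
noncomputable def SmoothFan.toFunctionField (σ : F.Cone) :
    CoordRing k σ.1 →+* (F.toricVariety k).functionField :=
  ((Scheme.ΓSpecIso (.of (CoordRing k σ.1))).inv ≫ ((F.chart k σ).appIso ⊤).inv ≫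
    (F.toricVariety k).germToFunctionField (F.affineOpen k σ)).hom

lemma toFunctionField_comp_algebraMap (σ : F.Cone) :
    (F.toFunctionField k σ).comp (algebraMap k (CoordRing k σ.1)) =
      algebraMap k (F.toricVariety k).functionField := by
  have h : CommRingCat.ofHom (algebraMap k (CoordRing k σ.1)) ≫
      (Scheme.ΓSpecIso (.of (CoordRing k σ.1))).inv ≫ ((F.chart k σ).appIso ⊤).inv ≫
      (F.toricVariety k).germToFunctionField (F.affineOpen k σ) =
      (Scheme.ΓSpecIso (.of k)).inv ≫ (F.structureMorphism k).appTop ≫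
    (F.toricVariety k).presheaf.germ ⊤ (genericPoint (F.toricVariety k)) trivial := by
    rw [Scheme.ΓSpecIso_inv_naturality_assoc, ← chart_structureMorphism, Scheme.Hom.comp_appTop,
      Category.assoc]
    congr 2
    erw [Scheme.Hom.app_appIso_inv_assoc]
    exact (F.toricVariety k).presheaf.germ_res _ (genericPoint (F.toricVariety k)) _
  exact congrArg CommRingCat.Hom.hom h

lemma toFunctionField_isFractionRing (σ : F.Cone) :
    letI := (F.toFunctionField k σ).toAlgebra
    IsFractionRing (CoordRing k σ.1) (F.toricVariety k).functionField := by
  let _ := (F.toFunctionField k σ).toAlgebra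
  have hU : IsAffineOpen (F.affineOpen k σ) := (isAffineOpen_top _).image_of_isOpenImmersion _
  have := functionField_isFractionRing_of_isAffineOpen _ _ hU
  let e : CoordRing k σ.1 ≃+* Γ(F.toricVariety k, F.affineOpen k σ) :=
    ((Scheme.ΓSpecIso (.of (CoordRing k σ.1))).symm ≪≫
      ((F.chart k σ).appIso ⊤).symm).commRingCatIsoToRingEquiv
  have he : algebraMap (CoordRing k σ.1) (F.toricVariety k).functionField =
      (algebraMap Γ(F.toricVariety k, F.affineOpen k σ) (F.toricVariety k).functionField).comp
        e.toRingHom := rfl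
  exact IsFractionRing.of_ringEquiv_left e fun x => rfl

end Fans

section
variable {N : Type u} [AddCommGroup N] (F : SmoothFan N)

/-- The rays `Σ(1)`, identified with their primitive generators. -/
abbrev SmoothFan.Ray : Type u := {v : N // {v} ∈ F.cones}

/-- A ray as a cone of the fan. -/
def SmoothFan.Ray.toCone {F : SmoothFan N} (ρ : F.Ray) : F.Cone := ⟨{ρ.1}, ρ.2⟩

noncomputable instance : Fintype F.Ray :=
  Fintype.ofInjective (SmoothFan.Ray.toCone (F := F)) fun ρ ρ' h => by
    simpa [SmoothFan.Ray.toCone, Subtype.ext_iff] using h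

/-- The rays generate `N_ℝ`. -/
def SmoothFan.RaysSpan : Prop :=
  Submodule.span ℝ (Set.range fun ρ : F.Ray => (1 : ℝ) ⊗ₜ[ℤ] ρ.1) = ⊤

/-- The set `Σ(n)` of full-dimensional cones, `n = rank N = dim X`. -/
abbrev SmoothFan.MaxCone : Type u := {σ : F.Cone // σ.1.card = Module.finrank ℤ N}

variable {F}
/-- A generator of `σ` as a ray of the fan. -/
def SmoothFan.MaxCone.ray (σ : F.MaxCone) (v : σ.1.1) : F.Ray :=
  ⟨v.1, F.face_mem _ σ.1.2 _ (Finset.singleton_subset_iff.2 v.2)⟩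

lemma SmoothFan.MaxCone.exists_basis (σ : F.MaxCone) :
    ∃ b : Module.Basis σ.1.1 ℤ N, ∀ v, b v = v.1 := by
  obtain ⟨b, hb⟩ := F.smooth _ σ.1.2
  choose f hf using fun v : σ.1.1 => hb v.2
  have hinj : Function.Injective f := fun v w h => Subtype.ext (by rw [← hf v, ← hf w, h])
  have hbij : Function.Bijective f :=
    (Fintype.bijective_iff_injective_and_card f).2 ⟨hinj, by simpa using σ.2⟩
  exact ⟨b.reindex (Equiv.ofBijective f hbij).symm, fun v => by simp [hf]⟩

/-- The basis of `N` formed by the generators of a full-dimensional cone. -/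
noncomputable def SmoothFan.MaxCone.basis (σ : F.MaxCone) : Module.Basis σ.1.1 ℤ N :=
  σ.exists_basis.choose

lemma SmoothFan.MaxCone.basis_apply (σ : F.MaxCone) (v : σ.1.1) : σ.basis v = v.1 :=
  σ.exists_basis.choose_spec v

/-- The element `ρ̂_σ ∈ M` of the basis dual to `σ(1)` with `⟨ρ̂_σ, ρ⟩ = 1`. -/
noncomputable def SmoothFan.MaxCone.dualGenerator (σ : F.MaxCone) (ρ : σ.1.1) : CharLattice N :=
  σ.basis.coord ρ

lemma SmoothFan.MaxCone.dualGenerator_apply (σ : F.MaxCone) (ρ v : σ.1.1) [Decidable (ρ = v)] :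
    σ.dualGenerator ρ v.1 = if ρ = v then 1 else 0 := by
  classical
  rw [← σ.basis_apply v, dualGenerator, Module.Basis.coord_apply, Module.Basis.repr_self,
    Finsupp.single_apply]
  simp [eq_comm]

open scoped Classical in
/-- The rays in `Σ(1) ∖ σ(1)`. -/
noncomputable def SmoothFan.MaxCone.otherRays (σ : F.MaxCone) : Finset F.Ray :=
  Finset.univ.filter fun ρ => ρ.1 ∉ σ.1.1

variable (F) (k : Type u) [Field k]

/-- The torus orbit `orb(σ)`: the closed subset of `U_σ` on which the `x^m` with
`m ∈ (σ^∨ ∩ M) ∖ σ^⊥` vanish. -/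
def SmoothFan.orbit (σ : F.Cone) : Set (F.toricVariety k) :=
  F.chart k σ '' (PrimeSpectrum.zeroLocus
    {f | ∃ m : dualMonoid σ.1, (∃ v ∈ σ.1, m.1 v ≠ 0) ∧ f = chi k m} :
      Set (PrimeSpectrum (CoordRing k σ.1)))

open scoped Classical in
/-- The torus invariant prime divisor `D_ρ`, the closure of `orb(ρ)`; its coefficient at `P` is
`δ_{D_ρ, P}`. -/
noncomputable def SmoothFan.toricDivisor (ρ : F.Ray) : ExtDivisor (F.toricVariety k) :=
  fun P => if closure {P.1} = closure (F.orbit k ρ.toCone) then 1 else 0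

/-- The character `x^m` as a rational function. -/
noncomputable def SmoothFan.character (m : CharLattice N) : (F.toricVariety k).functionField :=
  F.toFunctionField k F.zeroCone (chi k ⟨m, fun v hv => absurd hv (Finset.notMem_empty v)⟩)

/-- The pairing `⟨m, ·⟩ : N_K = K ⊗ N → K` of a character `m`. -/
noncomputable def pairing (K : Type u) [Field K] (m : CharLattice N) : K ⊗[ℤ] N →ₗ[K] K :=
  (TensorProduct.AlgebraTensorModule.rid ℤ K K).toLinearMap ∘ₗ m.baseChange K

lemma pairing_tmul (K : Type u) [Field K] (m : CharLattice N) (f : K) (v : N) :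
    pairing K m (f ⊗ₜ v) = m v • f := by
  simp [pairing]

lemma pairing_add (K : Type u) [Field K] (m m' : CharLattice N) (a : K ⊗[ℤ] N) :
    pairing K (m + m') a = pairing K m a + pairing K m' a := by
  simp [pairing, LinearMap.baseChange_add]

/-- The identification of `N_K` with the generic stalk `Der_k(K, K)` of the tangent sheaf, dual to
`dx^m / x^m ↔ m`: the derivation with `x^m ↦ ⟨m, a⟩ x^m`, see `logDerivation_character`. -/
noncomputable def SmoothFan.logDerivation (a : (F.toricVariety k).functionField ⊗[ℤ] N) :
    Derivation k (F.toricVariety k).functionField (F.toricVariety k).functionField :=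
  letI := (F.toFunctionField k F.zeroCone).toAlgebra
  haveI := toFunctionField_isFractionRing k F F.zeroCone
  haveI : IsScalarTower k (CoordRing k F.zeroCone.1) (F.toricVariety k).functionField :=
    .of_algebraMap_eq' (toFunctionField_comp_algebraMap k F F.zeroCone).symm
  extendDerivation (A := CoordRing k F.zeroCone.1) (weightDerivation
    { toFun := fun m => pairing (F.toricVariety k).functionField m.1 a
      map_zero' := by simp [pairing]
      map_add' := fun m m' => pairing_add _ _ _ _ })

lemma logDerivation_character (a : (F.toricVariety k).functionField ⊗[ℤ] N) (m : CharLattice N) :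
    F.logDerivation k a (F.character k m) =
      pairing (F.toricVariety k).functionField m a * F.character k m := by
  letI := (F.toFunctionField k F.zeroCone).toAlgebra
  haveI := toFunctionField_isFractionRing k F F.zeroCone
  haveI : IsScalarTower k (CoordRing k F.zeroCone.1) (F.toricVariety k).functionField :=
    .of_algebraMap_eq' (toFunctionField_comp_algebraMap k F F.zeroCone).symm
  exact (extendDerivation_algebraMap _ _).trans (weightDerivation_single _ _ _)
end

end Toric

/-!
The chart `U_σ` of a smooth cone is the spectrum of a localization of a polynomial ring in the
coordinates `x_i = x^{b_i^*}`, where `b` is a basis of `N` extending the generators of `σ`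
(`coordRing_isLocalization`). So the toric variety `X` is covered by affine opens with factorial
coordinate rings, which gives everything that is needed about divisors: the local ring at a prime
divisor is a discrete valuation ring, a rational function regular in codimension one is regular
(`mem_localSubring_of_forall_primeDivisor`), a nonzero rational function has finitely many zeros and
poles (`finite_ord_ne_zero`), and a Weil divisor is determined by its divisorial sheaf
(`divisor_le_of_divisorialSheaf`). The last fact is the uniqueness of the Weil decoration.

For existence, a derivation `δ` of the function field is a section of the tangent sheaf over `U` if
and only if it preserves the local rings `𝒪_P` of the prime divisors `P` meeting `U`
(`mem_tangentSheaf_iff`). If `P` meets `U_σ`, then `δ` preserves `𝒪_P` if and only if all `δ(x_i)`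
lie in `𝒪_P`, because `𝒪_P` is a localization of a ring generated by the `x_i` and the inverses of
some of them (`derivation_mem_of_forall_coord`). Applied to `f δ`, this shows that the coefficient
of the decoration at `P` is `min_i ord_P δ(x_i)` (`smul_preserves_localSubring_iff`,
`isWeilDecoration_tangentDecoration`).

For a full-dimensional `σ` and the derivation of `a ∈ N_K`, `δ(x_i) = ⟨ρ̂_σ, a⟩ x_i` where `ρ` is the
generator with index `i`, and the coordinate `x_i` has order `δ_{D_ρ, P}` at `P`
(`principalDivisor_coord_eq_toricDivisor`); this is the local formula. In the global formula, the
cones `σ` whose chart meets `P` all contribute the coefficient at `P`, since the divisors of the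
other rays do not meet `U_σ` (`toricDivisor_eq_zero`). If `P` does not meet `U_σ`, then `P = D_ρ₀`
for a ray `ρ₀` outside `σ` (`mem_affineOpen_zeroCone_or`). Take a full-dimensional cone `σ₀`
containing `ρ₀`: the dual generators of `σ` are integral combinations of those of `σ₀`, so the order
of `⟨ρ̂_σ, a⟩` at `P` is at least the coefficient at `P` minus one, and the summand `D_ρ₀` makes up
for the difference.
-/

namespace Toric

/-! ### Coordinates on a smooth affine toric variety -/

section Coordinates

variable {N : Type u} [AddCommGroup N] (k : Type u) [Field k] {σ : Finset N} {ι : Type*}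
  (b : Module.Basis ι ℤ N)

/-- The elements of the basis of `M` dual to a basis of `N` which extends the generators of `σ` lie
in `σ^∨`. -/
lemma coord_mem_dualMonoid (hb : (σ : Set N) ⊆ Set.range b) (i : ι) :
    b.coord i ∈ dualMonoid σ := by
  classical
  intro v hv
  obtain ⟨j, rfl⟩ := hb hv
  rw [Module.Basis.coord_apply, Module.Basis.repr_self, Finsupp.single_apply]
  split_ifs <;> simp

/-- The dual basis element `b_i^*` as an element of `σ^∨ ∩ M`. -/
noncomputable def dualCoord (hb : (σ : Set N) ⊆ Set.range b) (i : ι) : dualMonoid σ :=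
  ⟨b.coord i, coord_mem_dualMonoid b hb i⟩

variable (hb : (σ : Set N) ⊆ Set.range b)

lemma dualCoord_apply_self (i : ι) : (dualCoord b hb i).1 (b i) = 1 := by
  simp [dualCoord]

/-- The homomorphism `k[X_i] → k[σ^∨ ∩ M]`, `X_i ↦ x^{b_i^*}`, from the polynomial ring in the
coordinates on the affine toric variety of a smooth cone. -/
noncomputable def coordMap : MvPolynomial ι k →+* CoordRing k σ :=
  (MvPolynomial.aeval fun i => chi k (dualCoord b hb i)).toRingHom

lemma coordMap_X (i : ι) : coordMap k b hb (MvPolynomial.X i) = chi k (dualCoord b hb i) := by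
  simp [coordMap]

lemma coordMap_monomial [Fintype ι] (s : ι →₀ ℕ) (c : k) :
    coordMap k b hb (MvPolynomial.monomial s c) =
      AddMonoidAlgebra.single (∑ i, s i • dualCoord b hb i) c := by
  have hprod : ∀ t : Finset ι, ∏ i ∈ t, chi k (s i • dualCoord b hb i) =
      chi k (∑ i ∈ t, s i • dualCoord b hb i) := by
    classical
    intro t
    induction t using Finset.induction_on with
    | empty => simp [chi, AddMonoidAlgebra.one_def]
    | insert i t hi ih => rw [Finset.prod_insert hi, Finset.sum_insert hi, ih, chi_mul]
  have h : coordMap k b hb (MvPolynomial.monomial s c) =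
      algebraMap k (CoordRing k σ) c * ∏ i, chi k (dualCoord b hb i) ^ s i := by
    simp [coordMap, MvPolynomial.aeval_monomial, Finsupp.prod_fintype]
  rw [h]
  simp_rw [chi_pow]
  rw [hprod, chi, AddMonoidAlgebra.coe_algebraMap]
  simp [AddMonoidAlgebra.single_mul_single]

lemma eq_sum_dualCoord [Fintype ι] (m : CharLattice N) : m = ∑ i, m (b i) • b.coord i := by
  classical
  apply b.ext
  intro j
  simp

lemma coordMap_injective [Fintype ι] : Function.Injective (coordMap k b hb) := by
  classical
  have hinj : Function.Injective fun s : ι →₀ ℕ => ∑ i, s i • dualCoord b hb i := by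
    intro s t h
    ext j
    have := congrArg (fun m : dualMonoid σ => m.1 (b j)) h
    simpa [dualCoord, Finsupp.single_apply] using this
  have h : ∀ p, coordMap k b hb p =
      AddMonoidAlgebra.mapDomain (fun s : ι →₀ ℕ => ∑ i, s i • dualCoord b hb i) p := by
    intro p
    induction p using MvPolynomial.induction_on' with
    | monomial s c =>
      rw [coordMap_monomial, ← MvPolynomial.single_eq_monomial, AddMonoidAlgebra.mapDomain_single]
    | add p q hp hq =>
      rw [map_add, hp, hq]
      exact (AddMonoidAlgebra.mapDomain_add (R := k) _ _ _).symm
  intro p q hpq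
  rw [h, h] at hpq
  exact AddMonoidAlgebra.mapDomain_injective hinj hpq

open scoped Classical in
/-- The coordinate ring of a smooth affine toric variety is the localization of the polynomial ring
in the coordinates `x^{b_i^*}` at those coordinates for which `b_i` is not a generator of `σ`. -/
lemma coordRing_isLocalization [Fintype ι] :
    let _ := (coordMap k b hb).toAlgebra
    IsLocalization.Away (∏ i with b i ∉ σ, MvPolynomial.X i : MvPolynomial ι k)
      (CoordRing k σ) := by
  let _ := (coordMap k b hb).toAlgebra
  have hprod : coordMap k b hb (∏ i with b i ∉ σ, MvPolynomial.X i) =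
      chi k (∑ i with b i ∉ σ, dualCoord b hb i) := by
    rw [map_prod]
    simp_rw [coordMap_X]
    induction (Finset.univ.filter fun i => b i ∉ σ) using Finset.induction_on with
    | empty => simp [chi, AddMonoidAlgebra.one_def]
    | insert i t hi ih => rw [Finset.prod_insert hi, Finset.sum_insert hi, ih, chi_mul]
  have heval : ∀ j, (∑ i with b i ∉ σ, dualCoord b hb i).1 (b j) = if b j ∈ σ then 0 else 1 := by
    intro j
    simp [dualCoord, Finsupp.single_apply, Finset.sum_ite_eq]
  refine IsLocalization.Away.mk _ ?_ ?_ ?_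
  · rw [RingHom.algebraMap_toAlgebra, hprod]
    refine IsUnit.of_mul_eq_one (chi k ⟨-(∑ i with b i ∉ σ, dualCoord b hb i).1, ?_⟩) ?_
    · intro v hv
      obtain ⟨j, rfl⟩ := hb hv
      rw [LinearMap.neg_apply, heval, if_pos hv, neg_zero]
    · rw [chi_mul, AddMonoidAlgebra.one_def, chi]
      congr 1
      ext1
      simp
  · intro s
    rw [RingHom.algebraMap_toAlgebra, hprod]
    induction s using AddMonoidAlgebra.induction_linear with
    | zero => exact ⟨0, 0, by simp⟩
    | add f g hf hg =>
      obtain ⟨n, a, ha⟩ := hf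
      obtain ⟨n', a', ha'⟩ := hg
      refine ⟨n + n', a * (∏ i with b i ∉ σ, MvPolynomial.X i) ^ n' +
        a' * (∏ i with b i ∉ σ, MvPolynomial.X i) ^ n, ?_⟩
      rw [map_add, map_mul, map_mul, map_pow, map_pow, hprod, ← ha, ← ha']
      ring
    | single m c =>
      let n : ℕ := ∑ i, (m.1 (b i)).natAbs
      have hle : ∀ i, ((m.1 (b i)).natAbs : ℤ) ≤ n := fun i => by
        exact_mod_cast Finset.single_le_sum (f := fun i => (m.1 (b i)).natAbs)
          (fun _ _ => Nat.zero_le _) (Finset.mem_univ i)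
      refine ⟨n, MvPolynomial.monomial (Finsupp.equivFunOnFinite.symm fun i =>
        ((m + n • ∑ i with b i ∉ σ, dualCoord b hb i).1 (b i)).toNat) c, ?_⟩
      rw [coordMap_monomial, chi_pow, chi, AddMonoidAlgebra.single_mul_single, mul_one]
      congr 1
      ext1
      apply b.ext
      intro j
      have h1 : ∀ s : ι → ℕ, (∑ i, s i • dualCoord b hb i).1 (b j) = s j := by
        intro s
        simp [dualCoord, Finsupp.single_apply]
      rw [Finsupp.coe_equivFunOnFinite_symm, h1, Int.toNat_of_nonneg]
      simp only [AddSubmonoid.coe_add, LinearMap.add_apply, AddSubmonoidClass.coe_nsmul,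
        LinearMap.smul_apply, heval, nsmul_eq_mul]
      split_ifs with h
      · simpa using m.2 _ h
      · have := hle j
        omega
  · intro p q hpq
    exact ⟨0, by rw [coordMap_injective k b hb hpq]⟩

lemma coordRing_uniqueFactorizationMonoid (h : IsPartOfBasis σ) :
    UniqueFactorizationMonoid (CoordRing k σ) := by
  classical
  obtain ⟨b, hb⟩ := h
  let _ := (coordMap k b hb).toAlgebra
  have := coordRing_isLocalization k b hb
  exact UniqueFactorizationMonoid.of_isLocalization
    (Submonoid.powers (∏ i with b i ∉ σ, MvPolynomial.X i : MvPolynomial _ k)) _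

/-- The coordinate which cuts out the divisor of a ray of `σ` is a prime element of the coordinate
ring. -/
lemma chi_dualCoord_prime [Finite ι] {i : ι} (hi : b i ∈ σ) :
    Prime (chi k (dualCoord b hb i)) := by
  classical
  have := Fintype.ofFinite ι
  let _ := (coordMap k b hb).toAlgebra
  have := coordRing_isLocalization k b hb
  have hX : Prime (MvPolynomial.X i : MvPolynomial ι k) := MvPolynomial.X_prime
  have hp : (Ideal.span {(MvPolynomial.X i : MvPolynomial ι k)}).IsPrime :=
    (Ideal.span_singleton_prime hX.ne_zero).2 hX
  have hd : Disjoint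
      (Submonoid.powers (∏ i with b i ∉ σ, MvPolynomial.X i : MvPolynomial ι k) : Set _)
      (Ideal.span {(MvPolynomial.X i : MvPolynomial ι k)} : Set (MvPolynomial ι k)) := by
    rw [Set.disjoint_left]
    rintro _ ⟨n, rfl⟩ hn
    rw [SetLike.mem_coe, Ideal.mem_span_singleton] at hn
    obtain ⟨j, hj, hij⟩ := hX.exists_mem_finset_dvd (hX.dvd_of_dvd_pow hn)
    rw [MvPolynomial.X_dvd_X] at hij
    have := (Finset.mem_filter.1 hj).2
    rcases hij with rfl
    exact this hi
  have := IsLocalization.isPrime_of_isPrime_disjoint _ (CoordRing k σ) _ hp hd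
  rw [Ideal.map_span, Set.image_singleton, RingHom.algebraMap_toAlgebra, coordMap_X] at this
  refine (Ideal.span_singleton_prime ?_).1 this
  rw [← coordMap_X]
  exact (map_ne_zero_iff _ (coordMap_injective k b hb)).2 hX.ne_zero
end Coordinates

/-! ### Points of codimension one -/

section Points

variable {X : Scheme.{u}}

lemma coheight_add_one_le_of_specializes {x y : X} (h : y ⤳ x) (hne : y ≠ x) :
    Order.coheight y + 1 ≤ Order.coheight x :=
  Order.coheight_add_one_le (lt_of_le_not_ge h fun h' => hne ((Specializes.antisymm h h').eq))

/-- There are no proper specializations between prime divisors. -/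
lemma PrimeDivisor.eq_of_specializes {P Q : PrimeDivisor X} (h : Q.1 ⤳ P.1) : Q = P := by
  by_contra hne
  have h1 := coheight_add_one_le_of_specializes h fun he => hne (Subtype.ext he)
  rw [P.2, Q.2] at h1
  exact absurd h1 (by norm_num)

lemma mem_primeIdealOf_iff {U : X.Opens} (hU : IsAffineOpen U) {x : X} (hx : x ∈ U) (s : Γ(X, U)) :
    s ∈ (hU.primeIdealOf ⟨x, hx⟩).asIdeal ↔ x ∉ X.basicOpen s := by
  let _ := TopCat.Presheaf.algebra_section_stalk X.presheaf ⟨x, hx⟩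
  have := hU.isLocalization_stalk ⟨x, hx⟩
  have h := IsLocalization.AtPrime.isUnit_to_map_iff (X.presheaf.stalk x)
    (hU.primeIdealOf ⟨x, hx⟩).asIdeal s
  rw [X.mem_basicOpen s x hx]
  exact (not_iff_comm.1 h.symm).symm

lemma coheight_eq_height_primeIdealOf {U : X.Opens} (hU : IsAffineOpen U) (x : U) :
    Order.coheight x.1 = (hU.primeIdealOf x).asIdeal.height := by
  conv_lhs => rw [← hU.fromSpec_primeIdealOf x]
  exact (coheight_eq_of_isOpenImmersion hU.fromSpec).trans (idealHeight_eq_coheight _ _).symm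

end Points

/-! ### Local rings in the function field and regularity in codimension one -/

section LocalRings

variable {X : Scheme.{u}} [IsIntegral X]

/-- The local ring `𝒪_{X,x}` as a subring of the function field. -/
noncomputable def localSubring (x : X) : Subring X.functionField :=
  (algebraMap (X.presheaf.stalk x) X.functionField).range

lemma germToFunctionField_mem_localSubring {V : X.Opens} [Nonempty V] {x : X} (hx : x ∈ V)
    (g : Γ(X, V)) : X.germToFunctionField V g ∈ localSubring x :=
  ⟨X.presheaf.germ V x hx g, X.algebraMap_germ_eq_germToFunctionField hx g⟩

lemma germToFunctionField_res {V W : X.Opens} [Nonempty V] [Nonempty W] (h : W ≤ V) (g : Γ(X, V)) :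
    X.germToFunctionField W (X.presheaf.map (homOfLE h).op g) = X.germToFunctionField V g :=
  X.presheaf.germ_res_apply (homOfLE h) _ _ g

lemma exists_section_of_mem_localSubring {x : X} {f : X.functionField} (hf : f ∈ localSubring x)
    {U : X.Opens} (hx : x ∈ U) :
    ∃ V : X.Opens, ∃ _ : Nonempty V, x ∈ V ∧ V ≤ U ∧ ∃ g : Γ(X, V),
      X.germToFunctionField V g = f := by
  obtain ⟨s, rfl⟩ := hf
  obtain ⟨W, hW, g, rfl⟩ := X.presheaf.exists_germ_eq s
  have : Nonempty W := ⟨⟨x, hW⟩⟩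
  have : Nonempty (W ⊓ U : X.Opens) := ⟨⟨x, hW, hx⟩⟩
  refine ⟨W ⊓ U, this, ⟨hW, hx⟩, inf_le_right, X.presheaf.map (homOfLE inf_le_left).op g, ?_⟩
  exact (germToFunctionField_res inf_le_left g).trans
    (X.algebraMap_germ_eq_germToFunctionField hW g).symm

/-- A rational function is a section over `V` if and only if it is regular at all points of `V`. -/
lemma exists_section_iff (V : X.Opens) [Nonempty V] (f : X.functionField) :
    (∃ g : Γ(X, V), X.germToFunctionField V g = f) ↔ ∀ x ∈ V, f ∈ localSubring x := by
  refine ⟨fun ⟨g, hg⟩ x hx => hg ▸ germToFunctionField_mem_localSubring hx g, fun h => ?_⟩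
  choose W hne hxW hWV g hg using fun x : V =>
    exists_section_of_mem_localSubring (h x.1 x.2) x.2
  obtain ⟨s, hs, -⟩ := X.sheaf.existsUnique_gluing' W V (fun x => homOfLE (hWV x))
    (fun x hx => TopologicalSpace.Opens.mem_iSup.2 ⟨⟨x, hx⟩, hxW ⟨x, hx⟩⟩) g (by
      intro x y
      have hne' : Nonempty (W x ⊓ W y : X.Opens) := by
        have hx := (genericPoint_spec X).mem_open_set_iff (W x).isOpen
        have hy := (genericPoint_spec X).mem_open_set_iff (W y).isOpen
        exact ⟨⟨genericPoint X, hx.2 (by simpa using hne x), hy.2 (by simpa using hne y)⟩⟩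
      apply X.germToFunctionField_injective (W x ⊓ W y)
      exact (germToFunctionField_res inf_le_left (g x)).trans ((hg x).trans
        ((hg y).symm.trans (germToFunctionField_res inf_le_right (g y)).symm)))
  obtain ⟨x⟩ := ‹Nonempty V›
  have := hne x
  exact ⟨s, by rw [← hg x, ← germToFunctionField_res (hWV x) s]; exact congrArg _ (hs x)⟩

lemma inv_mem_localSubring_iff {V : X.Opens} [Nonempty V] {x : X} (hx : x ∈ V) {s : Γ(X, V)}
    (hs : s ≠ 0) :
    (X.germToFunctionField V s)⁻¹ ∈ localSubring x ↔ x ∈ X.basicOpen s := by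
  rw [X.mem_basicOpen s x hx]
  have h0 : X.germToFunctionField V s ≠ 0 :=
    (map_ne_zero_iff _ (X.germToFunctionField_injective V)).2 hs
  rw [← X.algebraMap_germ_eq_germToFunctionField hx] at h0 ⊢
  constructor
  · rintro ⟨t, ht⟩
    refine IsUnit.of_mul_eq_one t (IsFractionRing.injective (X.presheaf.stalk x) X.functionField ?_)
    rw [map_mul, ht, mul_inv_cancel₀ h0, map_one]
  · rintro ⟨t, ht⟩
    refine ⟨(t⁻¹ : (X.presheaf.stalk x)ˣ), ?_⟩
    rw [← ht]
    simp

/-- The local rings at the points of an affine open `U` are localizations of its ring of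
functions. -/
lemma exists_fraction_of_mem_localSubring {U : X.Opens} (hU : IsAffineOpen U) [Nonempty U] {x : X}
    (hx : x ∈ U) {f : X.functionField} (hf : f ∈ localSubring x) :
    ∃ a s : Γ(X, U), s ≠ 0 ∧ x ∈ X.basicOpen s ∧
      f = X.germToFunctionField U a * (X.germToFunctionField U s)⁻¹ := by
  obtain ⟨t, rfl⟩ := hf
  let _ := TopCat.Presheaf.algebra_section_stalk X.presheaf ⟨x, hx⟩
  have := hU.isLocalization_stalk ⟨x, hx⟩
  obtain ⟨⟨a, s⟩, has⟩ := IsLocalization.surj (hU.primeIdealOf ⟨x, hx⟩).asIdeal.primeCompl t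
  have hs0 : s.1 ≠ 0 := by
    rintro h0
    exact s.2 (by rw [h0]; exact zero_mem _)
  refine ⟨a, s.1, hs0, not_not.1 ((mem_primeIdealOf_iff hU hx s.1).not.1 s.2), ?_⟩
  have h0 : X.germToFunctionField U s.1 ≠ 0 :=
    (map_ne_zero_iff _ (X.germToFunctionField_injective U)).2 hs0
  rw [eq_mul_inv_iff_mul_eq₀ h0, ← X.algebraMap_germ_eq_germToFunctionField hx,
    ← X.algebraMap_germ_eq_germToFunctionField hx, ← map_mul]
  exact congrArg _ has

variable (X) in
/-- `X` is covered by affine opens whose coordinate rings are factorial. -/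
def HasFactorialCover : Prop :=
  ∀ x : X, ∃ U : X.Opens, IsAffineOpen U ∧ x ∈ U ∧ UniqueFactorizationMonoid Γ(X, U)

/-- On a factorial scheme, a rational function which is regular in codimension one is regular. -/
lemma mem_localSubring_of_forall_primeDivisor [IsLocallyNoetherian X]
    (hX : HasFactorialCover X) {x : X}
    {f : X.functionField} (h : ∀ P : PrimeDivisor X, P.1 ⤳ x → f ∈ localSubring P.1) :
    f ∈ localSubring x := by
  obtain ⟨U, hU, hx, _⟩ := hX x
  have : Nonempty U := ⟨⟨x, hx⟩⟩
  have := functionField_isFractionRing_of_isAffineOpen X U hU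
  obtain ⟨a, b, hab, rfl⟩ := IsFractionRing.exists_reduced_fraction Γ(X, U) f
  have hb0 : b.1 ≠ 0 := nonZeroDivisors.ne_zero b.2
  have hmk : IsLocalization.mk' X.functionField a b =
      X.germToFunctionField U a * (X.germToFunctionField U b.1)⁻¹ := by
    rw [IsFractionRing.mk'_eq_div, div_eq_mul_inv]
    rfl
  rw [hmk] at h ⊢
  refine mul_mem (germToFunctionField_mem_localSubring hx a)
    ((inv_mem_localSubring_iff hx hb0).2 ?_)
  by_contra hbx
  -- Otherwise some prime factor `p` of the denominator vanishes at `x`.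
  have hb := (mem_primeIdealOf_iff hU hx b.1).2 hbx
  obtain ⟨p, hpx, hp, hpb⟩ : ∃ p ∈ (hU.primeIdealOf ⟨x, hx⟩).asIdeal, Prime p ∧ p ∣ b.1 := by
    obtain ⟨m, hm, hmb⟩ := UniqueFactorizationMonoid.exists_prime_factors b.1 hb0
    have hmem : m.prod ∈ (hU.primeIdealOf ⟨x, hx⟩).asIdeal := by
      rw [← Ideal.Quotient.eq_zero_iff_mem] at hb ⊢
      obtain ⟨u, hu⟩ := hmb
      rw [← hu, map_mul] at hb
      exact (mul_eq_zero.1 hb).resolve_right (u.isUnit.map _).ne_zero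
    obtain ⟨p, hpm, hpx⟩ := ((hU.primeIdealOf ⟨x, hx⟩).isPrime.multiset_prod_mem_iff_exists_mem
      m).1 hmem
    exact ⟨p, hpx, hm p hpm, (Multiset.dvd_prod hpm).trans hmb.dvd⟩
  have hpI : (Ideal.span {p}).IsPrime := (Ideal.span_singleton_prime hp.ne_zero).2 hp
  let q : PrimeSpectrum Γ(X, U) := ⟨Ideal.span {p}, hpI⟩
  have hqx : q ⤳ hU.primeIdealOf ⟨x, hx⟩ := by
    rw [← PrimeSpectrum.le_iff_specializes]
    exact (Ideal.span_singleton_le_iff_mem _).2 hpx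
  have hspec : hU.fromSpec q ⤳ x := by
    have := hqx.map hU.fromSpec.continuous
    rwa [hU.fromSpec_primeIdealOf] at this
  have hqU : hU.fromSpec q ∈ U := hspec.mem_open U.isOpen hx
  have hq : hU.primeIdealOf ⟨_, hqU⟩ = q :=
    hU.fromSpec.isOpenEmbedding.injective (hU.fromSpec_primeIdealOf ⟨_, hqU⟩)
  have hq1 : Order.coheight (hU.fromSpec q) = 1 := by
    have := coheight_eq_height_primeIdealOf hU ⟨_, hqU⟩
    rw [hq] at this
    rw [this]
    have : IsNoetherianRing Γ(X, U) := IsLocallyNoetherian.component_noetherian ⟨U, hU⟩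
    exact Ideal.height_span_singleton_eq_one_of_mem_nonZeroDivisors
      (mem_nonZeroDivisors_of_ne_zero hp.ne_zero) hp.not_isUnit
  have hmem : ∀ c : Γ(X, U), hU.fromSpec q ∉ X.basicOpen c ↔ p ∣ c := fun c => by
    rw [← mem_primeIdealOf_iff hU hqU c, hq]
    exact Ideal.mem_span_singleton
  obtain ⟨t, ht⟩ := h ⟨_, hq1⟩ hspec
  have h0 : X.germToFunctionField U b.1 ≠ 0 :=
    (map_ne_zero_iff _ (X.germToFunctionField_injective U)).2 hb0
  rw [eq_mul_inv_iff_mul_eq₀ h0, ← X.algebraMap_germ_eq_germToFunctionField hqU,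
    ← X.algebraMap_germ_eq_germToFunctionField hqU, ← map_mul] at ht
  replace ht := IsFractionRing.injective (X.presheaf.stalk (hU.fromSpec q)) X.functionField ht
  have hpa : p ∣ a := by
    rw [← hmem, X.mem_basicOpen a _ hqU, ← ht]
    intro hunit
    have hbU := (hmem b.1).2 hpb
    rw [X.mem_basicOpen b.1 _ hqU] at hbU
    exact hbU (isUnit_of_mul_isUnit_right hunit)
  exact hp.not_isUnit (hab hpa hpb)

end LocalRings

/-! ### Orders of rational functions along prime divisors -/

section Valuations

variable {X : Scheme.{u}} [IsIntegral X] [IsLocallyNoetherian X]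

/-- The local ring of a factorial scheme at a prime divisor is a discrete valuation ring. -/
lemma isDiscreteValuationRing_stalk (hX : HasFactorialCover X) (P : PrimeDivisor X) :
    IsDiscreteValuationRing (X.presheaf.stalk P.1) := by
  obtain ⟨U, hU, hx, _⟩ := hX P.1
  have : Nonempty U := ⟨⟨_, hx⟩⟩
  let _ := TopCat.Presheaf.algebra_section_stalk X.presheaf ⟨P.1, hx⟩
  have := hU.isLocalization_stalk ⟨P.1, hx⟩
  have hht : (hU.primeIdealOf ⟨P.1, hx⟩).asIdeal.height = 1 :=
    (coheight_eq_height_primeIdealOf hU ⟨P.1, hx⟩).symm.trans P.2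
  have hprin := UniqueFactorizationMonoid.isPrincipal_of_height_eq_one hht
  have hmax : (IsLocalRing.maximalIdeal (X.presheaf.stalk P.1)).IsPrincipal := by
    rw [← IsLocalization.AtPrime.map_eq_maximalIdeal (hU.primeIdealOf ⟨P.1, hx⟩).asIdeal]
    infer_instance
  have hfield : ¬ IsField (X.presheaf.stalk P.1) := by
    intro hf
    have h := ringKrullDim_stalk_eq_coheight P.1
    rw [ringKrullDim_eq_zero_of_isField hf, P.2] at h
    exact absurd h (by norm_num)
  exact ((IsDiscreteValuationRing.TFAE _ hfield).out 0 4).2 hmax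

lemma principalDivisor_zero (P : PrimeDivisor X) : principalDivisor (0 : X.functionField) P = ⊤ :=
  if_pos rfl

lemma principalDivisor_of_ne_zero {f : X.functionField} (hf : f ≠ 0) (P : PrimeDivisor X) :
    principalDivisor f P = (Scheme.ord f P.1 : ℤ) :=
  if_neg hf

lemma principalDivisor_eq_top_iff {f : X.functionField} {P : PrimeDivisor X} :
    principalDivisor f P = ⊤ ↔ f = 0 := by
  by_cases hf : f = 0
  · simp [hf, principalDivisor_zero]
  · simp [hf, principalDivisor_of_ne_zero]

lemma principalDivisor_mul (f g : X.functionField) (P : PrimeDivisor X) :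
    principalDivisor (f * g) P = principalDivisor f P + principalDivisor g P := by
  by_cases hf : f = 0
  · simp [hf, principalDivisor_zero]
  by_cases hg : g = 0
  · simp [hg, principalDivisor_zero]
  rw [principalDivisor_of_ne_zero hf, principalDivisor_of_ne_zero hg,
    principalDivisor_of_ne_zero (mul_ne_zero hf hg), Scheme.ord_mul hf hg]
  rfl

lemma principalDivisor_one (P : PrimeDivisor X) :
    principalDivisor (1 : X.functionField) P = 0 := by
  have h := principalDivisor_mul (1 : X.functionField) 1 P
  rw [one_mul, principalDivisor_of_ne_zero one_ne_zero] at h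
  rw [principalDivisor_of_ne_zero one_ne_zero]
  norm_cast at h ⊢
  omega

lemma principalDivisor_nonneg_iff (hX : HasFactorialCover X) {f : X.functionField}
    {P : PrimeDivisor X} : 0 ≤ principalDivisor f P ↔ f ∈ localSubring P.1 := by
  by_cases hf : f = 0
  · simp [hf, principalDivisor_zero, zero_mem]
  have := isDiscreteValuationRing_stalk hX P
  rw [principalDivisor_of_ne_zero hf, ← WithTop.coe_zero, WithTop.coe_le_coe,
    Scheme.le_ord_iff P.2 hf]
  have h : Scheme.ordHom P.1 P.2 f = ((IsDiscreteValuationRing.maximalIdeal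
      (X.presheaf.stalk P.1)).valuation X.functionField f)⁻¹ :=
    Ring.ordFrac_eq_valuation_inv f
  rw [h, ofAdd_zero, WithZero.coe_one, one_le_inv₀ (by simpa [zero_lt_iff] using hf)]
  constructor
  · intro h1
    obtain ⟨g, hg⟩ := IsDiscreteValuationRing.exists_lift_of_le_one h1
    exact ⟨g, hg⟩
  · rintro ⟨g, rfl⟩
    exact IsDedekindDomain.HeightOneSpectrum.valuation_le_one _ g

lemma principalDivisor_add (hX : HasFactorialCover X) (f g : X.functionField)
    (P : PrimeDivisor X) :
    min (principalDivisor f P) (principalDivisor g P) ≤ principalDivisor (f + g) P := by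
  have := isDiscreteValuationRing_stalk hX P
  by_cases hf : f = 0
  · simp [hf]
  by_cases hg : g = 0
  · simp [hg]
  by_cases hfg : f + g = 0
  · simp [hfg, principalDivisor_zero]
  rw [principalDivisor_of_ne_zero hf, principalDivisor_of_ne_zero hg,
    principalDivisor_of_ne_zero hfg]
  exact_mod_cast Scheme.ord_add hfg

/-- A rational function of prescribed order at a prime divisor. -/
lemma exists_principalDivisor_eq (hX : HasFactorialCover X) (P : PrimeDivisor X) (n : ℤ) :
    ∃ f : X.functionField, f ≠ 0 ∧ principalDivisor f P = n := by
  have := isDiscreteValuationRing_stalk hX P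
  obtain ⟨ϖ, hϖ⟩ := IsDiscreteValuationRing.exists_irreducible (X.presheaf.stalk P.1)
  have hne : algebraMap (X.presheaf.stalk P.1) X.functionField ϖ ≠ 0 :=
    (map_ne_zero_iff _ (IsFractionRing.injective _ _)).2 hϖ.ne_zero
  refine ⟨algebraMap (X.presheaf.stalk P.1) X.functionField ϖ ^ n, zpow_ne_zero _ hne, ?_⟩
  rw [principalDivisor_of_ne_zero (zpow_ne_zero _ hne), WithTop.coe_eq_coe,
    Scheme.ord_eq_iff P.2 (zpow_ne_zero _ hne), map_zpow₀]
  have h : Scheme.ordHom P.1 P.2 (algebraMap (X.presheaf.stalk P.1) X.functionField ϖ) =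
      WithZero.exp 1 := Ring.ordFrac_irreducible hϖ
  rw [h, ← WithZero.exp_zsmul, smul_eq_mul, mul_one]
  rfl

/-- A nonzero rational function has zeros and poles along finitely many prime divisors only. -/
lemma finite_ord_ne_zero [CompactSpace X] {f : X.functionField} (hf : f ≠ 0) :
    {P : PrimeDivisor X | Scheme.ord f P.1 ≠ 0}.Finite := by
  have : AlgebraicGeometry.IsNoetherian X := {}
  obtain ⟨U, -, f', hne, rfl, hunit⟩ := exists_isUnit_germ_eq X f hf
  obtain ⟨S, hS, hSc, hSi, hSU⟩ :=
    TopologicalSpace.NoetherianSpace.exists_finite_set_isClosed_irreducible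
      U.isOpen.isClosed_compl
  -- A point of codimension one outside `U` is the generic point of a component of `X ∖ U`.
  have key : ∀ P : PrimeDivisor X, Scheme.ord (X.germToFunctionField U f') P.1 ≠ 0 →
      closure {P.1} ∈ S := by
    intro P hP
    have hPU : P.1 ∈ (U : Set X)ᶜ := fun h => hP (Scheme.ord_of_isUnit hunit h)
    rw [hSU] at hPU
    obtain ⟨Z, hZS, hPZ⟩ := hPU
    obtain ⟨c, hc⟩ := QuasiSober.sober (hSi Z hZS) (hSc Z hZS)
    have hcP : c ⤳ P.1 := hc.specializes hPZ
    have hcU : c ∉ U := by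
      have : c ∈ (U : Set X)ᶜ := hSU ▸ Set.mem_sUnion_of_mem hc.mem hZS
      exact this
    have hPc : P.1 = c := by
      by_contra hne'
      have h3 := coheight_add_one_le_of_specializes hcP (Ne.symm hne')
      have h4 := coheight_add_one_le_of_specializes (genericPoint_specializes c) (by
        rintro rfl
        exact hcU (((genericPoint_spec X).mem_open_set_iff U.isOpen).2 (by simpa using hne)))
      rw [P.2] at h3
      have h5 : (2 : ℕ∞) ≤ 1 := by
        calc (2 : ℕ∞) = 0 + 1 + 1 := by norm_num
          _ ≤ Order.coheight (genericPoint X) + 1 + 1 := by gcongr; exact zero_le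
          _ ≤ Order.coheight c + 1 := by gcongr
          _ ≤ 1 := h3
      exact absurd h5 (by norm_num)
    rw [hPc, hc.def]
    exact hZS
  refine Set.Finite.of_finite_image (f := fun P : PrimeDivisor X => closure {P.1})
    (hS.subset ?_) ?_
  · rintro _ ⟨P, hP, rfl⟩
    exact key P hP
  · intro P _ Q _ h
    exact Subtype.ext ((specializes_iff_closure_subset.2 h.ge).antisymm
      (specializes_iff_closure_subset.2 h.le)).eq

/-- A Weil divisor on a factorial scheme is determined by its divisorial sheaf. -/
lemma divisor_le_of_divisorialSheaf [CompactSpace X] (hX : HasFactorialCover X) {D D' : Divisor X}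
    (h : ∀ U : X.Opens, (U : Set X).Nonempty → divisorialSheaf D U ⊆ divisorialSheaf D' U)
    (P : PrimeDivisor X) : D P ≤ D' P := by
  obtain ⟨f, hf, hfP⟩ := exists_principalDivisor_eq hX P (-D P)
  -- `f` is a section of `𝒪_X(D)` near `P`: away from the finitely many other prime divisors `Q`
  -- where `D + div f` can be negative.
  let B : Set (PrimeDivisor X) := {Q | D Q + Scheme.ord f Q.1 < 0}
  have hB : B.Finite := ((finite_ord_ne_zero hf).union D.hasFiniteSupport).subset fun Q hQ => by
    by_contra hcon
    simp only [Set.mem_union, Set.mem_ofPred_eq, Function.mem_support, not_or, not_not] at hcon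
    have : D Q + Scheme.ord f Q.1 < 0 := hQ
    omega
  rw [principalDivisor_of_ne_zero hf, WithTop.coe_eq_coe] at hfP
  let U : X.Opens := ⟨(⋃ Q ∈ B, closure {Q.1})ᶜ,
    (hB.isClosed_biUnion fun _ _ => isClosed_closure).isOpen_compl⟩
  have hPU : P.1 ∈ U := by
    intro hP
    obtain ⟨Q, hQ, hPQ⟩ := Set.mem_iUnion₂.1 hP
    have hlt : D Q + Scheme.ord f Q.1 < 0 := hQ
    rw [PrimeDivisor.eq_of_specializes (specializes_iff_mem_closure.2 hPQ), hfP] at hlt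
    omega
  have hfU : f ∈ divisorialSheaf D U := by
    intro Q hQ
    have hQB : ¬ D Q + Scheme.ord f Q.1 < 0 := fun hlt =>
      hQ (Set.mem_iUnion₂.2 ⟨Q, hlt, subset_closure rfl⟩)
    rw [Pi.add_apply, principalDivisor_of_ne_zero hf, Divisor.toExt]
    exact_mod_cast not_lt.1 hQB
  have := h U ⟨_, hPU⟩ hfU P hPU
  rw [Pi.add_apply, principalDivisor_of_ne_zero hf, hfP, Divisor.toExt] at this
  have h' : 0 ≤ D' P + -D P := by exact_mod_cast this
  omega

end Valuations

/-! ### Charts of the toric variety -/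

section Charts

/-- Functions on `Spec A` and on an open subscheme `Spec B`, as sections of the ambient scheme. -/
lemma appIso_inv_res {A B : CommRingCat.{u}} (φ : A ⟶ B) {X : Scheme.{u}} (j : Spec A ⟶ X)
    (g : Spec B ⟶ X) [IsOpenImmersion j] [IsOpenImmersion g] (h : Spec.map φ ≫ j = g)
    (hle : g ''ᵁ ⊤ ≤ j ''ᵁ ⊤) :
    (Scheme.ΓSpecIso A).inv ≫ (j.appIso ⊤).inv ≫ X.presheaf.map (homOfLE hle).op =
      φ ≫ (Scheme.ΓSpecIso B).inv ≫ (g.appIso ⊤).inv := by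
  subst h
  rw [← cancel_mono ((Spec.map φ ≫ j).appIso ⊤).hom]
  simp only [Category.assoc, Iso.inv_hom_id, Category.comp_id]
  rw [Scheme.Hom.appIso_hom', Scheme.Hom.map_appLE,
    ← Scheme.Hom.appLE_comp_appLE (Spec.map φ) j (j ''ᵁ ⊤) ⊤ ⊤ (by simp) (by simp),
    Scheme.Hom.appIso_inv_appLE_assoc]
  rw [Scheme.ΓSpecIso_inv_naturality]
  simp [Scheme.Hom.appLE]
  exact Category.comp_id _

variable {N : Type u} [AddCommGroup N] (F : SmoothFan N) (k : Type u) [Field k]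

/-- The identification `k[σ^∨ ∩ M] = 𝒪(U_σ)`. -/
noncomputable def SmoothFan.chartSection (σ : F.Cone) :
    CoordRing k σ.1 ≃+* Γ(F.toricVariety k, F.affineOpen k σ) :=
  ((Scheme.ΓSpecIso (.of (CoordRing k σ.1))).symm ≪≫
    ((F.chart k σ).appIso ⊤).symm).commRingCatIsoToRingEquiv

lemma germToFunctionField_chartSection (σ : F.Cone) (a : CoordRing k σ.1) :
    (F.toricVariety k).germToFunctionField (F.affineOpen k σ) (F.chartSection k σ a) =
      F.toFunctionField k σ a := rfl

lemma isAffineOpen_affineOpen (σ : F.Cone) : IsAffineOpen (F.affineOpen k σ) :=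
  (isAffineOpen_top _).image_of_isOpenImmersion _

lemma chart_mem_affineOpen (σ : F.Cone) (q : PrimeSpectrum (CoordRing k σ.1)) :
    F.chart k σ q ∈ F.affineOpen k σ := ⟨q, trivial, rfl⟩

lemma exists_chart_eq {σ : F.Cone} {x : F.toricVariety k} (hx : x ∈ F.affineOpen k σ) :
    ∃ q : PrimeSpectrum (CoordRing k σ.1), F.chart k σ q = x := by
  obtain ⟨q, -, hq⟩ := hx
  exact ⟨q, hq⟩

lemma exists_mem_affineOpen (x : F.toricVariety k) : ∃ σ : F.Cone, x ∈ F.affineOpen k σ := by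
  obtain ⟨σ, y, rfl⟩ := Scheme.IsLocallyDirected.ι_jointly_surjective (F.diagram k) x
  exact ⟨σ, y, trivial, rfl⟩

/-- A point of `U_σ ∩ U_τ` lies in `U_λ` for a common face `λ` of `σ` and `τ`. -/
lemma exists_common_face {σ τ : F.Cone} {x : F.toricVariety k} (hσ : x ∈ F.affineOpen k σ)
    (hτ : x ∈ F.affineOpen k τ) : ∃ l : F.Cone, l ≤ σ ∧ l ≤ τ ∧ x ∈ F.affineOpen k l := by
  obtain ⟨q, rfl⟩ := exists_chart_eq F k hσ
  obtain ⟨q', hq⟩ := exists_chart_eq F k hτ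
  obtain ⟨l, f, g, y, hy, -⟩ := (Scheme.IsLocallyDirected.ι_eq_ι_iff (F.diagram k)).1 hq.symm
  refine ⟨l, leOfHom f, leOfHom g, y, trivial, ?_⟩
  have hf : (F.diagram k).map f ≫ F.chart k σ = F.chart k l := colimit.w _ f
  rw [← hy, ← hf]
  rfl

lemma affineOpen_mono {τ σ : F.Cone} (h : τ ≤ σ) : F.affineOpen k τ ≤ F.affineOpen k σ := by
  let f : τ ⟶ σ := homOfLE h
  have hf : (F.diagram k).map f ≫ F.chart k σ = F.chart k τ := colimit.w _ f
  rintro _ ⟨y, -, rfl⟩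
  refine ⟨(F.diagram k).map f y, trivial, ?_⟩
  rw [← hf]
  rfl

instance : CompactSpace (F.toricVariety k) := by
  have : Finite F.Cone := inferInstance
  have h : (⋃ σ : F.Cone, Set.range (F.chart k σ)) = Set.univ := by
    rw [Set.eq_univ_iff_forall]
    intro x
    obtain ⟨σ, hσ⟩ := exists_mem_affineOpen F k x
    obtain ⟨q, rfl⟩ := exists_chart_eq F k hσ
    exact Set.mem_iUnion.2 ⟨σ, q, rfl⟩
  rw [← isCompact_univ_iff, ← h]
  exact isCompact_iUnion fun σ => isCompact_range (F.chart k σ).continuous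

lemma hasFactorialCover_toricVariety : HasFactorialCover (F.toricVariety k) := by
  intro x
  obtain ⟨σ, hσ⟩ := exists_mem_affineOpen F k x
  exact ⟨F.affineOpen k σ, isAffineOpen_affineOpen F k σ, hσ,
    (F.chartSection k σ).toMulEquiv.uniqueFactorizationMonoid
      (coordRing_uniqueFactorizationMonoid k (F.smooth _ σ.2))⟩

lemma chart_mem_basicOpen_iff (σ : F.Cone) (q : PrimeSpectrum (CoordRing k σ.1))
    (s : CoordRing k σ.1) :
    F.chart k σ q ∈ (F.toricVariety k).basicOpen (F.chartSection k σ s) ↔ s ∉ q.asIdeal := by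
  have h := Scheme.image_basicOpen (F.chart k σ)
    ((Scheme.ΓSpecIso (.of (CoordRing k σ.1))).inv s)
  rw [basicOpen_eq_of_affine] at h
  have h' : (F.toricVariety k).basicOpen (F.chartSection k σ s) =
    (F.chart k σ) ''ᵁ (show (Spec (.of (CoordRing k σ.1))).Opens from PrimeSpectrum.basicOpen s) :=
    h.symm
  rw [h']
  constructor
  · rintro ⟨q', hq', hqq⟩
    rw [← (F.chart k σ).isOpenEmbedding.injective hqq]
    exact hq'
  · intro hs
    exact ⟨q, hs, rfl⟩

lemma toFunctionField_mem_localSubring {σ : F.Cone} {x : F.toricVariety k}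
    (hx : x ∈ F.affineOpen k σ) (a : CoordRing k σ.1) :
    F.toFunctionField k σ a ∈ localSubring x :=
  germToFunctionField_mem_localSubring hx (F.chartSection k σ a)

lemma inv_toFunctionField_mem_localSubring_iff (σ : F.Cone) (q : PrimeSpectrum (CoordRing k σ.1))
    {s : CoordRing k σ.1} (hs : s ≠ 0) :
    (F.toFunctionField k σ s)⁻¹ ∈ localSubring (F.chart k σ q) ↔ s ∉ q.asIdeal := by
  rw [← chart_mem_basicOpen_iff]
  exact inv_mem_localSubring_iff (chart_mem_affineOpen F k σ q)
    ((map_ne_zero_iff _ (F.chartSection k σ).injective).2 hs)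

lemma exists_toFunctionField_fraction {σ : F.Cone} {x : F.toricVariety k}
    (hx : x ∈ F.affineOpen k σ) {f : (F.toricVariety k).functionField} (hf : f ∈ localSubring x) :
    ∃ a s : CoordRing k σ.1, s ≠ 0 ∧ (F.toFunctionField k σ s)⁻¹ ∈ localSubring x ∧
      f = F.toFunctionField k σ a * (F.toFunctionField k σ s)⁻¹ := by
  obtain ⟨a, s, hs, hxs, rfl⟩ :=
    exists_fraction_of_mem_localSubring (isAffineOpen_affineOpen F k σ) hx hf
  obtain ⟨a, rfl⟩ := (F.chartSection k σ).surjective a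
  obtain ⟨s, rfl⟩ := (F.chartSection k σ).surjective s
  exact ⟨a, s, (map_ne_zero_iff _ (F.chartSection k σ).injective).1 hs,
    (inv_mem_localSubring_iff hx hs).2 hxs, rfl⟩

lemma toFunctionField_coordRingMap {τ σ : F.Cone} (h : τ ≤ σ) (a : CoordRing k σ.1) :
    F.toFunctionField k τ (coordRingMap k h a) = F.toFunctionField k σ a := by
  let f : τ ⟶ σ := homOfLE h
  have hf : (F.diagram k).map f ≫ F.chart k σ = F.chart k τ := colimit.w _ f
  have hres : F.chartSection k τ (coordRingMap k h a) =
      (F.toricVariety k).presheaf.map (homOfLE (affineOpen_mono F k h)).op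
        (F.chartSection k σ a) :=
    (congrArg (fun φ => φ.hom a) (appIso_inv_res (CommRingCat.ofHom (coordRingMap k h))
      (F.chart k σ) (F.chart k τ) hf (affineOpen_mono F k h))).symm
  rw [← germToFunctionField_chartSection, ← germToFunctionField_chartSection, hres]
  exact germToFunctionField_res (affineOpen_mono F k h) _

/-- The characters are the monomials in each of the charts. -/
lemma toFunctionField_chi (σ : F.Cone) (m : dualMonoid σ.1) :
    F.toFunctionField k σ (chi k m) = F.character k m.1 := by
  have h : F.zeroCone ≤ σ := Finset.empty_subset σ.1
  exact (toFunctionField_coordRingMap F k h (chi k m)).symm.trans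
    (congrArg _ (coordRingMap_chi k h m))

end Charts

/-! ### Derivations and local rings -/

section Derivations

section
variable {k K : Type*} [Field k] [Field K] [Algebra k K]

/-- The elements of a subring `R` of a field `K` which a derivation of `K` sends into the
`R`-submodule `I` of `K`. -/
def derivationSubring (δ : Derivation k K K) (R : Subring K) (I : Submodule R K) : Subring K where
  carrier := {g | g ∈ R ∧ δ g ∈ I}
  zero_mem' := ⟨zero_mem _, by simp⟩
  one_mem' := ⟨one_mem _, by simp⟩
  add_mem' {f g} hf hg := ⟨add_mem hf.1 hg.1, by rw [map_add]; exact add_mem hf.2 hg.2⟩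
  neg_mem' {f} hf := ⟨neg_mem hf.1, by rw [map_neg]; exact neg_mem hf.2⟩
  mul_mem' {f g} hf hg := ⟨mul_mem hf.1 hg.1, by
    rw [Derivation.leibniz]
    exact add_mem (I.smul_mem ⟨f, hf.1⟩ hg.2) (I.smul_mem ⟨g, hg.1⟩ hf.2)⟩

lemma inv_mem_derivationSubring {δ : Derivation k K K} {R : Subring K} {I : Submodule R K} {g : K}
    (hg : g ∈ derivationSubring δ R I) (hinv : g⁻¹ ∈ R) : g⁻¹ ∈ derivationSubring δ R I := by
  refine ⟨hinv, ?_⟩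
  rw [Derivation.leibniz_inv]
  exact I.smul_mem ⟨-g⁻¹ ^ 2, neg_mem (pow_mem hinv 2)⟩ hg.2
end

/-- A derivation is a section of the tangent sheaf of a factorial scheme if and only if it preserves
the local rings at the prime divisors. -/
lemma mem_tangentSheaf_iff {k : Type u} [Field k] {X : Scheme.{u}} [IsIntegral X]
    [IsLocallyNoetherian X] [Algebra k X.functionField] (hX : HasFactorialCover X) {U : X.Opens}
    {δ : Derivation k X.functionField X.functionField} :
    δ ∈ tangentSheaf k X U ↔
      ∀ P : PrimeDivisor X, P.1 ∈ U → ∀ g ∈ localSubring P.1, δ g ∈ localSubring P.1 := by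
  constructor
  · intro h P hP g hg
    obtain ⟨V, _, hPV, hVU, g, rfl⟩ := exists_section_of_mem_localSubring hg hP
    obtain ⟨g', hg'⟩ := h V hVU g
    rw [hg']
    exact germToFunctionField_mem_localSubring hPV g'
  · intro h V _ hVU g
    obtain ⟨g', hg'⟩ := (exists_section_iff V (δ (X.germToFunctionField V g))).2 fun x hx =>
      mem_localSubring_of_forall_primeDivisor hX fun P hP =>
        h P (hVU (hP.mem_open V.isOpen hx)) _
          (germToFunctionField_mem_localSubring (hP.mem_open V.isOpen hx) g)
    exact ⟨g', hg'.symm⟩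

section
variable {N : Type u} [AddCommGroup N] (F : SmoothFan N) (k : Type u) [Field k]

lemma character_zero : F.character k 0 = 1 := by
  rw [SmoothFan.character, ← map_one (F.toFunctionField k F.zeroCone)]
  rfl

lemma character_add (m m' : CharLattice N) :
    F.character k (m + m') = F.character k m * F.character k m' := by
  rw [SmoothFan.character, SmoothFan.character, SmoothFan.character, ← map_mul, chi_mul]
  rfl

lemma character_ne_zero (m : CharLattice N) : F.character k m ≠ 0 := by
  intro h
  have h1 := character_add F k m (-m)
  rw [add_neg_cancel, character_zero, h, zero_mul] at h1
  exact one_ne_zero h1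

lemma character_neg (m : CharLattice N) : F.character k (-m) = (F.character k m)⁻¹ := by
  refine eq_inv_of_mul_eq_one_left ?_
  rw [← character_add, neg_add_cancel, character_zero]

lemma character_nsmul (n : ℕ) (m : CharLattice N) :
    F.character k (n • m) = F.character k m ^ n := by
  induction n with
  | zero => rw [zero_smul, pow_zero, character_zero]
  | succ n ih => rw [succ_nsmul, character_add, ih, pow_succ]

variable {F k}

lemma character_mem_localSubring {σ : F.Cone} {x : F.toricVariety k} (hx : x ∈ F.affineOpen k σ)
    {m : CharLattice N} (hm : m ∈ dualMonoid σ.1) : F.character k m ∈ localSubring x := by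
  rw [← toFunctionField_chi F k σ ⟨m, hm⟩]
  exact toFunctionField_mem_localSubring F k hx _

variable {ι : Type*} [Finite ι] (b : Module.Basis ι ℤ N)

/-- Over `U_σ` a derivation is controlled by its values at the coordinates `x^{b_i^*}` for a basis
`b` of `N` which extends the generators of `σ`: these coordinates and the inverses of those of them
which are invertible on `U_σ` generate the coordinate ring. -/
lemma derivation_mem_of_forall_coord {σ : F.Cone} (hb : (σ.1 : Set N) ⊆ Set.range b)
    {x : F.toricVariety k} (hx : x ∈ F.affineOpen k σ)
    {δ : Derivation k (F.toricVariety k).functionField (F.toricVariety k).functionField}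
    (I : Submodule (localSubring x) (F.toricVariety k).functionField)
    (h : ∀ i, δ (F.character k (b.coord i)) ∈ I) :
    ∀ g ∈ localSubring x, δ g ∈ I := by
  classical
  have := Fintype.ofFinite ι
  have hcoord : ∀ i, F.character k (b.coord i) ∈ derivationSubring δ (localSubring x) I :=
    fun i => ⟨character_mem_localSubring hx (coord_mem_dualMonoid b hb i), h i⟩
  have hchar : ∀ m ∈ dualMonoid σ.1,
      F.character k m ∈ derivationSubring δ (localSubring x) I := by
    intro m hm
    have hmul : ∀ i, F.character k (m (b i) • b.coord i) ∈
        derivationSubring δ (localSubring x) I := by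
      intro i
      rcases Int.eq_nat_or_neg (m (b i)) with ⟨n, hn | hn⟩
      · rw [hn, natCast_zsmul, character_nsmul]
        exact pow_mem (hcoord i) n
      · by_cases hi : b i ∈ σ.1
        · have h0 : n = 0 := by
            have := hm _ hi
            omega
          rw [hn, h0]
          simp only [Nat.cast_zero, neg_zero, zero_smul, character_zero]
          exact one_mem _
        · rw [hn, neg_smul, natCast_zsmul, ← smul_neg, character_nsmul, character_neg]
          refine pow_mem (inv_mem_derivationSubring (hcoord i) ?_) n
          rw [← character_neg]
          refine character_mem_localSubring hx fun v hv => ?_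
          obtain ⟨j, rfl⟩ := hb hv
          have hij : j ≠ i := by rintro rfl; exact hi hv
          simp [hij]
    have hsum : ∀ t : Finset ι, F.character k (∑ i ∈ t, m (b i) • b.coord i) ∈
        derivationSubring δ (localSubring x) I := by
      intro t
      induction t using Finset.induction_on with
      | empty => rw [Finset.sum_empty, character_zero]; exact one_mem _
      | insert i t hi ih =>
        rw [Finset.sum_insert hi, character_add]
        exact mul_mem (hmul i) ih
    rw [eq_sum_dualCoord b m]
    exact hsum _
  have hconst : ∀ c : k, algebraMap k (F.toricVariety k).functionField c ∈
      derivationSubring δ (localSubring x) I := by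
    intro c
    refine ⟨?_, by simp⟩
    rw [← toFunctionField_comp_algebraMap k F σ]
    exact toFunctionField_mem_localSubring F k hx _
  have hfun : ∀ a : CoordRing k σ.1,
      F.toFunctionField k σ a ∈ derivationSubring δ (localSubring x) I := by
    intro a
    induction a using AddMonoidAlgebra.induction_linear with
    | zero => rw [map_zero]; exact zero_mem _
    | add a a' ha ha' => rw [map_add]; exact add_mem ha ha'
    | single m c =>
      have hmc : (AddMonoidAlgebra.single m c : CoordRing k σ.1) =
          algebraMap k (CoordRing k σ.1) c * chi k m := by
        simp [chi, AddMonoidAlgebra.single_mul_single]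
      rw [hmc, map_mul, toFunctionField_chi]
      refine mul_mem ?_ (hchar _ m.2)
      have := hconst c
      rwa [← toFunctionField_comp_algebraMap k F σ] at this
  intro g hg
  obtain ⟨a, s, -, hs, rfl⟩ := exists_toFunctionField_fraction F k hx hg
  exact (mul_mem (hfun a) (inv_mem_derivationSubring (hfun s) hs)).2

lemma derivation_eq_zero_of_forall_coord
    {δ : Derivation k (F.toricVariety k).functionField (F.toricVariety k).functionField}
    (h : ∀ i, δ (F.character k (b.coord i)) = 0) : δ = 0 := by
  ext g
  have hgen : ∀ {V : (F.toricVariety k).Opens}, Nonempty V →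
      genericPoint (F.toricVariety k) ∈ V := fun {V} hV =>
    ((genericPoint_spec (F.toricVariety k)).mem_open_set_iff V.isOpen).2 (by simpa using hV)
  have hg : g ∈ localSubring (genericPoint (F.toricVariety k)) := by
    obtain ⟨V, hV, s, rfl⟩ := (F.toricVariety k).presheaf.exists_germ_eq g
    have : Nonempty V := ⟨⟨_, hV⟩⟩
    exact germToFunctionField_mem_localSubring hV s
  have := derivation_mem_of_forall_coord (F := F) (k := k) (σ := F.zeroCone) b
    (by simp [SmoothFan.zeroCone]) (hgen inferInstance) (δ := δ) ⊥ (by simpa using h) g hg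
  simpa using this

end
end Derivations

/-! ### The Weil decoration of the tangent sheaf -/

section Decoration

variable {N : Type u} [AddCommGroup N] {F : SmoothFan N} {k : Type u} [Field k]

/-- The coefficients `min_i ord_P δ(x^{b_i^*})` of a derivation `δ` with respect to the coordinates
given by a basis `b` of `N`. -/
noncomputable def coordOrder {ι : Type*} [Fintype ι] (b : Module.Basis ι ℤ N)
    (δ : Derivation k (F.toricVariety k).functionField (F.toricVariety k).functionField) :
    ExtDivisor (F.toricVariety k) := fun P =>
  Finset.univ.inf fun i => principalDivisor (δ (F.character k (b.coord i))) P

lemma add_finset_inf {ι : Type*} (s : Finset ι) (c : WithTop ℤ) (f : ι → WithTop ℤ) :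
    c + s.inf f = s.inf fun i => c + f i :=
  Finset.apply_inf_eq_inf_comp (c + ·) (fun a b => (min_add_add_left c a b).symm) (by simp)

lemma smul_preserves_localSubring_iff {ι : Type*} [Fintype ι] (b : Module.Basis ι ℤ N) {σ : F.Cone}
    (hb : (σ.1 : Set N) ⊆ Set.range b) {P : PrimeDivisor (F.toricVariety k)}
    (hP : P.1 ∈ F.affineOpen k σ)
    (δ : Derivation k (F.toricVariety k).functionField (F.toricVariety k).functionField)
    (f : (F.toricVariety k).functionField) :
    (∀ g ∈ localSubring P.1, (f • δ) g ∈ localSubring P.1) ↔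
      0 ≤ principalDivisor f P + coordOrder b δ P := by
  have hX := hasFactorialCover_toricVariety F k
  rw [coordOrder, add_finset_inf, Finset.le_inf_iff]
  have hiff : ∀ i, 0 ≤ principalDivisor f P + principalDivisor (δ (F.character k (b.coord i))) P ↔
      (f • δ) (F.character k (b.coord i)) ∈ localSubring P.1 := fun i => by
    rw [← principalDivisor_mul, principalDivisor_nonneg_iff hX]
    rfl
  simp only [hiff]
  constructor
  · intro h i _
    exact h _ (character_mem_localSubring hP (coord_mem_dualMonoid b hb i))
  · intro h g hg
    let I : Submodule (localSubring P.1) (F.toricVariety k).functionField :=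
      { carrier := localSubring P.1
        zero_mem' := zero_mem _
        add_mem' := add_mem
        smul_mem' := fun c x hx => mul_mem c.2 hx }
    exact derivation_mem_of_forall_coord b hb hP I (fun i => h i (Finset.mem_univ i)) g hg

/-- An element of `ℤ ∪ {∞}` is determined by the rational functions whose order at a prime divisor
compensates it. -/
lemma le_of_forall_principalDivisor {X : Scheme.{u}} [IsIntegral X] [IsLocallyNoetherian X]
    (hX : HasFactorialCover X) {P : PrimeDivisor X} {c c' : WithTop ℤ}
    (h : ∀ f : X.functionField, 0 ≤ principalDivisor f P + c → 0 ≤ principalDivisor f P + c') :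
    c ≤ c' := by
  induction c' using WithTop.recTopCoe with
  | top => exact le_top
  | coe m =>
    obtain ⟨f, -, hf⟩ := exists_principalDivisor_eq hX P (-(m + 1))
    have hc := h f
    rw [hf] at hc
    induction c using WithTop.recTopCoe with
    | top =>
      have : (0 : ℤ) ≤ -(m + 1) + m := by exact_mod_cast hc (by simp)
      omega
    | coe n =>
      norm_cast at hc ⊢
      omega

/-- The coefficient of a derivation at a prime divisor does not depend on the coordinates. -/
lemma coordOrder_eq {ι ι' : Type*} [Fintype ι] [Fintype ι'] (b : Module.Basis ι ℤ N)
    (b' : Module.Basis ι' ℤ N) {σ σ' : F.Cone} (hb : (σ.1 : Set N) ⊆ Set.range b)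
    (hb' : (σ'.1 : Set N) ⊆ Set.range b') {P : PrimeDivisor (F.toricVariety k)}
    (hP : P.1 ∈ F.affineOpen k σ) (hP' : P.1 ∈ F.affineOpen k σ')
    (δ : Derivation k (F.toricVariety k).functionField (F.toricVariety k).functionField) :
    coordOrder b δ P = coordOrder b' δ P := by
  have hX := hasFactorialCover_toricVariety F k
  have h : ∀ f, 0 ≤ principalDivisor f P + coordOrder b δ P ↔
      0 ≤ principalDivisor f P + coordOrder b' δ P := fun f =>
    (smul_preserves_localSubring_iff b hb hP δ f).symm.trans
      (smul_preserves_localSubring_iff b' hb' hP' δ f)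
  exact le_antisymm (le_of_forall_principalDivisor hX fun f => (h f).1)
    (le_of_forall_principalDivisor hX fun f => (h f).2)

/-- A basis of `N` extending the generators of a cone of a smooth fan. -/
noncomputable def SmoothFan.coneBasis (F : SmoothFan N) (σ : F.Cone) :
    Module.Basis (Fin (Module.finrank ℤ N)) ℤ N :=
  (F.smooth _ σ.2).choose

lemma subset_range_coneBasis (σ : F.Cone) : (σ.1 : Set N) ⊆ Set.range (F.coneBasis σ) :=
  (F.smooth _ σ.2).choose_spec

variable (F k) in
/-- The Weil decoration of the tangent sheaf of a smooth toric variety; the coefficient at `P` is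
computed in a chart containing the generic point of `P`. -/
noncomputable def tangentDecoration
    (δ : Derivation k (F.toricVariety k).functionField (F.toricVariety k).functionField) :
    ExtDivisor (F.toricVariety k) := fun P =>
  coordOrder (F.coneBasis (exists_mem_affineOpen F k P.1).choose) δ P

lemma tangentDecoration_eq {ι : Type*} [Fintype ι] (b : Module.Basis ι ℤ N) {σ : F.Cone}
    (hb : (σ.1 : Set N) ⊆ Set.range b) {P : PrimeDivisor (F.toricVariety k)}
    (hP : P.1 ∈ F.affineOpen k σ)
    (δ : Derivation k (F.toricVariety k).functionField (F.toricVariety k).functionField) :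
    tangentDecoration F k δ P = coordOrder b δ P :=
  coordOrder_eq _ b (subset_range_coneBasis _) hb (exists_mem_affineOpen F k P.1).choose_spec hP δ

lemma coordOrder_ne_top {ι : Type*} [Fintype ι] (b : Module.Basis ι ℤ N)
    {δ : Derivation k (F.toricVariety k).functionField (F.toricVariety k).functionField}
    (hδ : δ ≠ 0) (P : PrimeDivisor (F.toricVariety k)) : coordOrder b δ P ≠ ⊤ := by
  intro h
  refine hδ (derivation_eq_zero_of_forall_coord b fun i => ?_)
  rw [coordOrder, Finset.inf_eq_top_iff] at h
  exact principalDivisor_eq_top_iff.1 (h i (Finset.mem_univ i))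

lemma finite_coordOrder_ne_zero {ι : Type*} [Fintype ι] (b : Module.Basis ι ℤ N)
    {δ : Derivation k (F.toricVariety k).functionField (F.toricVariety k).functionField}
    (hδ : δ ≠ 0) : {P : PrimeDivisor (F.toricVariety k) | coordOrder b δ P ≠ 0}.Finite := by
  have hfin : (⋃ i ∈ {i | δ (F.character k (b.coord i)) ≠ 0},
      {P : PrimeDivisor (F.toricVariety k) |
        Scheme.ord (δ (F.character k (b.coord i))) P.1 ≠ 0}).Finite :=
    (Set.toFinite _).biUnion fun i hi => finite_ord_ne_zero hi
  refine hfin.subset fun P hP => ?_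
  by_contra hcon
  simp only [Set.mem_iUnion, Set.mem_ofPred_eq, not_exists, not_not] at hcon
  apply hP
  obtain ⟨i, hi⟩ : ∃ i, δ (F.character k (b.coord i)) ≠ 0 := by
    by_contra! h
    exact hδ (derivation_eq_zero_of_forall_coord b h)
  apply le_antisymm
  · refine (Finset.inf_le (Finset.mem_univ i)).trans ?_
    rw [principalDivisor_of_ne_zero hi, hcon i hi]
    rfl
  · refine Finset.le_inf fun j _ => ?_
    by_cases hj : δ (F.character k (b.coord j)) = 0
    · simp [hj, principalDivisor_zero]
    · rw [principalDivisor_of_ne_zero hj, hcon j hj]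
      rfl

lemma finite_tangentDecoration_ne_zero
    {δ : Derivation k (F.toricVariety k).functionField (F.toricVariety k).functionField}
    (hδ : δ ≠ 0) :
    {P : PrimeDivisor (F.toricVariety k) | tangentDecoration F k δ P ≠ 0}.Finite := by
  refine (Set.finite_iUnion fun σ : F.Cone =>
    finite_coordOrder_ne_zero (F.coneBasis σ) hδ).subset fun P hP => ?_
  obtain ⟨σ, hσ⟩ := exists_mem_affineOpen F k P.1
  rw [Set.mem_ofPred_eq, tangentDecoration_eq (F.coneBasis σ) (subset_range_coneBasis σ) hσ] at hP
  exact Set.mem_iUnion.2 ⟨σ, hP⟩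

variable (F k) in
lemma isWeilDecoration_tangentDecoration :
    IsWeilDecoration (tangentSheaf k (F.toricVariety k)) (tangentDecoration F k) where
  map_zero := by
    funext P
    simp [tangentDecoration, coordOrder, principalDivisor_zero]
  map_ne_zero := by
    intro δ hδ
    have htop : ∀ P, tangentDecoration F k δ P ≠ ⊤ := fun P => coordOrder_ne_top _ hδ P
    let D : Divisor (F.toricVariety k) :=
      Finsupp.ofSupportFinite (fun P => (tangentDecoration F k δ P).untop (htop P))
        ((finite_tangentDecoration_ne_zero hδ).subset fun P hP h0 => hP (by simp [h0]))
    have hD : tangentDecoration F k δ = D.toExt := by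
      funext P
      exact (WithTop.coe_untop _ (htop P)).symm
    refine ⟨D, hD, fun U _ f => ?_⟩
    rw [mem_tangentSheaf_iff (hasFactorialCover_toricVariety F k)]
    refine forall₂_congr fun P _ => ?_
    rw [← hD, Pi.add_apply, add_comm]
    exact (smul_preserves_localSubring_iff _ (subset_range_coneBasis _)
      (exists_mem_affineOpen F k P.1).choose_spec δ f).symm

end Decoration

/-- A subsheaf of a constant sheaf on a factorial scheme has at most one Weil decoration. -/
lemma IsWeilDecoration.unique {X : Scheme.{u}} [IsIntegral X] [IsLocallyNoetherian X]
    [CompactSpace X] (hX : HasFactorialCover X) {V : Type u} [AddCommGroup V]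
    [Module X.functionField V] {E : X.Opens → AddSubgroup V} {W W' : V → ExtDivisor X}
    (hW : IsWeilDecoration E W) (hW' : IsWeilDecoration E W') : W = W' := by
  funext e
  by_cases he : e = 0
  · rw [he, hW.map_zero, hW'.map_zero]
  obtain ⟨D, hD, h⟩ := hW.map_ne_zero e he
  obtain ⟨D', hD', h'⟩ := hW'.map_ne_zero e he
  have heq : D = D' := Finsupp.ext fun P => le_antisymm
    (divisor_le_of_divisorialSheaf hX (fun U hU f hf => (h' U hU f).2 ((h U hU f).1 hf)) P)
    (divisor_le_of_divisorialSheaf hX (fun U hU f hf => (h U hU f).2 ((h' U hU f).1 hf)) P)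
  rw [hD, hD', heq]

/-! ### Torus invariant prime divisors -/

section Orbits

variable {N : Type u} [AddCommGroup N] {F : SmoothFan N} {k : Type u} [Field k]

lemma inv_character_mem_localSubring_iff {σ : F.Cone} (q : PrimeSpectrum (CoordRing k σ.1))
    (m : dualMonoid σ.1) :
    (F.character k m.1)⁻¹ ∈ localSubring (F.chart k σ q) ↔ chi k m ∉ q.asIdeal := by
  rw [← toFunctionField_chi]
  refine inv_toFunctionField_mem_localSubring_iff F k σ q fun h => ?_
  have := toFunctionField_chi F k σ m
  rw [h, map_zero] at this
  exact character_ne_zero F k m.1 this.symm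

/-- The chart of a face of `σ` contains the locus in `U_σ` where a character that cuts out the face
is invertible. -/
lemma mem_affineOpen_of_face {τ σ : F.Cone} (h : τ ≤ σ) {m : CharLattice N}
    (hmσ : m ∈ dualMonoid σ.1) (hm : ∀ v ∈ σ.1, m v = 0 ↔ v ∈ τ.1) {x : F.toricVariety k}
    (hx : x ∈ F.affineOpen k σ) (hinv : (F.character k m)⁻¹ ∈ localSubring x) :
    x ∈ F.affineOpen k τ := by
  obtain ⟨q, rfl⟩ := exists_chart_eq F k hx
  have hq := (inv_character_mem_localSubring_iff q ⟨m, hmσ⟩).1 hinv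
  have hrange := (diagram_map_isOpenImmersion_range k F (homOfLE h) ⟨m, hmσ⟩ hm).2
  have hf : (F.diagram k).map (homOfLE h) ≫ F.chart k σ = F.chart k τ := colimit.w _ _
  obtain ⟨y, hy⟩ : q ∈ Set.range ((F.diagram k).map (homOfLE h)) := by
    rw [hrange]
    exact hq
  refine ⟨y, trivial, ?_⟩
  rw [← hf, ← hy]
  rfl

lemma mem_orbit_iff {ρ : F.Ray} {x : F.toricVariety k} :
    x ∈ F.orbit k ρ.toCone ↔ x ∈ F.affineOpen k ρ.toCone ∧
      ∀ m : CharLattice N, 0 < m ρ.1 → (F.character k m)⁻¹ ∉ localSubring x := by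
  have hmem : ∀ m : CharLattice N, 0 < m ρ.1 → m ∈ dualMonoid ρ.toCone.1 := by
    intro m hm v hv
    rw [Finset.mem_singleton.1 hv]
    exact hm.le
  constructor
  · rintro ⟨q, hq, rfl⟩
    refine ⟨chart_mem_affineOpen F k _ q, fun m hm => ?_⟩
    rw [inv_character_mem_localSubring_iff q ⟨m, hmem m hm⟩, not_not]
    exact hq ⟨⟨m, hmem m hm⟩, ⟨ρ.1, Finset.mem_singleton_self _, hm.ne'⟩, rfl⟩
  · rintro ⟨hx, h⟩
    obtain ⟨q, rfl⟩ := exists_chart_eq F k hx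
    refine ⟨q, ?_, rfl⟩
    rintro _ ⟨m, ⟨v, hv, hmv⟩, rfl⟩
    have hv' := Finset.mem_singleton.1 hv
    have hm : 0 < m.1 ρ.1 := hv' ▸ lt_of_le_of_ne (m.2 v hv) hmv.symm
    have := h m.1 hm
    rwa [inv_character_mem_localSubring_iff, not_not] at this

lemma height_eq_one_of_chart_eq {σ : F.Cone} {P : PrimeDivisor (F.toricVariety k)}
    {q : PrimeSpectrum (CoordRing k σ.1)} (hq : F.chart k σ q = P.1) : q.asIdeal.height = 1 := by
  refine (idealHeight_eq_coheight (.of (CoordRing k σ.1)) q).trans ?_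
  refine (coheight_eq_of_isOpenImmersion (F.chart k σ)).symm.trans ?_
  exact (congrArg Order.coheight hq).trans P.2

lemma asIdeal_eq_span_of_inv_character_notMem {ι : Type*} [Finite ι] (b : Module.Basis ι ℤ N)
    {σ : F.Cone} (hb : (σ.1 : Set N) ⊆ Set.range b) {i : ι} (hi : b i ∈ σ.1)
    {P : PrimeDivisor (F.toricVariety k)} {q : PrimeSpectrum (CoordRing k σ.1)}
    (hq : F.chart k σ q = P.1) (h : (F.character k (b.coord i))⁻¹ ∉ localSubring P.1) :
    q.asIdeal = Ideal.span {chi k (dualCoord b hb i)} := by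
  rw [← hq] at h
  have h' := (inv_character_mem_localSubring_iff q (dualCoord b hb i)).not.1 h
  exact Ideal.eq_span_singleton_of_height_eq_one (height_eq_one_of_chart_eq hq) (not_not.1 h')
    (chi_dualCoord_prime k b hb hi)

open scoped Classical in
/-- A coordinate has order one along the divisor which it cuts out. -/
lemma principalDivisor_coord {ι : Type*} [Finite ι] (b : Module.Basis ι ℤ N) {σ : F.Cone}
    (hb : (σ.1 : Set N) ⊆ Set.range b) {i : ι} (hi : b i ∈ σ.1)
    {P : PrimeDivisor (F.toricVariety k)} (hP : P.1 ∈ F.affineOpen k σ) :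
    principalDivisor (F.character k (b.coord i)) P =
      if (F.character k (b.coord i))⁻¹ ∈ localSubring P.1 then 0 else 1 := by
  have hX := hasFactorialCover_toricVariety F k
  have hnonneg : 0 ≤ principalDivisor (F.character k (b.coord i)) P :=
    (principalDivisor_nonneg_iff hX).2
      (character_mem_localSubring hP (coord_mem_dualMonoid b hb i))
  have hinv : ∀ f : (F.toricVariety k).functionField, f ≠ 0 →
      principalDivisor f P + principalDivisor f⁻¹ P = 0 := fun f hf => by
    rw [← principalDivisor_mul, mul_inv_cancel₀ hf, principalDivisor_one]
  have hx := hinv _ (character_ne_zero F k (b.coord i))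
  split_ifs with h
  · rw [← principalDivisor_nonneg_iff hX] at h
    exact le_antisymm ((le_add_of_nonneg_right h).trans hx.le) hnonneg
  obtain ⟨q, hq⟩ := exists_chart_eq F k hP
  have hspan := asIdeal_eq_span_of_inv_character_notMem b hb hi hq h
  apply le_antisymm
  · -- A uniformizer is a fraction whose numerator is divisible by the coordinate.
    obtain ⟨t, ht0, ht⟩ := exists_principalDivisor_eq hX P 1
    have htP : t ∈ localSubring P.1 := by
      rw [← principalDivisor_nonneg_iff hX, ht]
      exact_mod_cast zero_le_one
    obtain ⟨a, s, hs0, hs, rfl⟩ := exists_toFunctionField_fraction F k hP htP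
    have ha0 : F.toFunctionField k σ a ≠ 0 := left_ne_zero_of_mul ht0
    have ha : a ∈ q.asIdeal := by
      by_contra ha
      rw [← inv_toFunctionField_mem_localSubring_iff F k σ q (by rintro rfl; simp at ha0), hq,
        ← principalDivisor_nonneg_iff hX] at ha
      have hs' : 0 ≤ principalDivisor (F.toFunctionField k σ s) P :=
        (principalDivisor_nonneg_iff hX).2 (toFunctionField_mem_localSubring F k hP s)
      have h1 := hinv _ ht0
      rw [mul_inv, inv_inv, principalDivisor_mul _ (F.toFunctionField k σ s), ht] at h1
      have h2 : ((1 : ℤ) : WithTop ℤ) ≤ 0 := by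
        rw [← h1]
        exact le_add_of_nonneg_right (add_nonneg ha hs')
      norm_cast at h2
    rw [hspan, Ideal.mem_span_singleton] at ha
    obtain ⟨c, rfl⟩ := ha
    rw [map_mul, toFunctionField_chi, principalDivisor_mul, principalDivisor_mul, add_assoc] at ht
    have hc : 0 ≤ principalDivisor (F.toFunctionField k σ c) P :=
      (principalDivisor_nonneg_iff hX).2 (toFunctionField_mem_localSubring F k hP c)
    have hs' := (principalDivisor_nonneg_iff hX).2 hs
    refine (le_add_of_nonneg_right (add_nonneg hc hs')).trans ?_
    exact ht.le
  · rw [← principalDivisor_nonneg_iff hX] at h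
    rw [principalDivisor_of_ne_zero (character_ne_zero F k _)] at hnonneg hx ⊢
    rw [principalDivisor_of_ne_zero (inv_ne_zero (character_ne_zero F k _))] at h hx
    norm_cast at *
    omega

/-- A coordinate is invertible at the generic point of a prime divisor meeting `U_σ` unless this
divisor is the closure of the orbit of the corresponding ray; in that case the generic point lies in
the chart of the ray. -/
lemma closure_eq_closure_orbit_iff {ι : Type*} [Finite ι] (b : Module.Basis ι ℤ N) {σ : F.Cone}
    (hb : (σ.1 : Set N) ⊆ Set.range b) {i : ι} {ρ : F.Ray} (hρ : b i = ρ.1) (hi : ρ.1 ∈ σ.1)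
    {P : PrimeDivisor (F.toricVariety k)} (hP : P.1 ∈ F.affineOpen k σ) :
    (closure {P.1} = closure (F.orbit k ρ.toCone) ↔
      (F.character k (b.coord i))⁻¹ ∉ localSubring P.1) ∧
    ((F.character k (b.coord i))⁻¹ ∉ localSubring P.1 → P.1 ∈ F.affineOpen k ρ.toCone) := by
  classical
  have := Fintype.ofFinite ι
  have hρσ : ρ.toCone ≤ σ := Finset.singleton_subset_iff.2 hi
  have hbρ : (ρ.toCone.1 : Set N) ⊆ Set.range b := fun v hv => hb (hρσ hv)
  have hiσ : b i ∈ σ.1 := hρ ▸ hi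
  have hiρ : b i ∈ ρ.toCone.1 := Finset.mem_singleton.2 hρ
  have hchi0 : F.chartSection k σ (chi k (dualCoord b hb i)) ≠ 0 :=
    (map_ne_zero_iff _ (F.chartSection k σ).injective).2 (chi_dualCoord_prime k b hb hiσ).ne_zero
  have hopen : ∀ y ∈ F.affineOpen k σ, (F.character k (b.coord i))⁻¹ ∈ localSubring y ↔
      y ∈ (F.toricVariety k).basicOpen (F.chartSection k σ (chi k (dualCoord b hb i))) := by
    intro y hy
    rw [← inv_mem_localSubring_iff hy hchi0, germToFunctionField_chartSection,
      toFunctionField_chi]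
    rfl
  have hface : (F.character k (b.coord i))⁻¹ ∉ localSubring P.1 →
      P.1 ∈ F.affineOpen k ρ.toCone := by
    intro h
    obtain ⟨m, hm⟩ := exists_face_equation (F.smooth _ σ.2) hρσ
    refine mem_affineOpen_of_face hρσ m.2 hm hP ?_
    obtain ⟨q, hq⟩ := exists_chart_eq F k hP
    rw [← hq, inv_character_mem_localSubring_iff q m,
      asIdeal_eq_span_of_inv_character_notMem b hb hiσ hq h, Ideal.mem_span_singleton]
    rintro ⟨c, hc⟩
    have h0 : (chi k (dualCoord b hb i) * c).coeff m = 0 :=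
      AddMonoidAlgebra.coeff_single_mul_of_forall_add_ne _ _ (by
        rintro d rfl
        have h1 := (hm (b i) hiσ).2 hiρ
        have h2 := d.2 (b i) hiσ
        have h3 := dualCoord_apply_self b hb i
        simp only [AddSubmonoid.coe_add, LinearMap.add_apply] at h1
        omega)
    rw [← hc] at h0
    simp [chi] at h0
  refine ⟨⟨fun hcl hinv => ?_, fun h => ?_⟩, hface⟩
  · rw [hopen _ hP] at hinv
    have hPcl : P.1 ∈ closure (F.orbit k ρ.toCone) := hcl ▸ subset_closure rfl
    obtain ⟨y, hyV, hyo⟩ := mem_closure_iff.1 hPcl _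
      ((F.toricVariety k).basicOpen _).isOpen hinv
    obtain ⟨hyρ, hy⟩ := mem_orbit_iff.1 hyo
    exact hy (b.coord i) (by rw [← hρ]; simp) ((hopen y (affineOpen_mono F k hρσ hyρ)).2 hyV)
  · have hPρ := hface h
    have hPo : P.1 ∈ F.orbit k ρ.toCone := by
      refine mem_orbit_iff.2 ⟨hPρ, fun m hm hinv => h ?_⟩
      have hsub : m - b.coord i ∈ dualMonoid ρ.toCone.1 := by
        intro v hv
        rw [Finset.mem_singleton.1 hv, LinearMap.sub_apply, ← hρ] at *
        simp only [Module.Basis.coord_apply, Module.Basis.repr_self, Finsupp.single_eq_same]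
        omega
      have hmul : (F.character k (b.coord i))⁻¹ =
          (F.character k m)⁻¹ * F.character k (m - b.coord i) := by
        rw [← character_neg, ← character_neg, ← character_add]
        congr 1
        abel
      rw [hmul]
      exact mul_mem hinv (character_mem_localSubring hPρ hsub)
    obtain ⟨q, hq⟩ := exists_chart_eq F k hPρ
    have hspan := asIdeal_eq_span_of_inv_character_notMem b hbρ hiρ hq h
    refine (closure_mono (Set.singleton_subset_iff.2 hPo)).antisymm
      (closure_minimal ?_ isClosed_closure)
    rintro _ ⟨q', hq', rfl⟩
    have hle : q ⤳ q' := by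
      refine (PrimeSpectrum.le_iff_specializes q q').1 ?_
      refine hspan.le.trans ((Ideal.span_singleton_le_iff_mem _).2 (hq' ⟨_, ⟨b i, hiρ, ?_⟩, rfl⟩))
      rw [dualCoord_apply_self]
      exact one_ne_zero
    rw [← specializes_iff_mem_closure, ← hq]
    exact hle.map (F.chart k ρ.toCone).continuous

/-- On `U_σ` the divisor of a coordinate is the torus invariant divisor of the corresponding
generator of `σ`. -/
lemma principalDivisor_coord_eq_toricDivisor {ι : Type*} [Finite ι] (b : Module.Basis ι ℤ N)
    {σ : F.Cone} (hb : (σ.1 : Set N) ⊆ Set.range b) {i : ι} {ρ : F.Ray} (hρ : b i = ρ.1)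
    (hi : ρ.1 ∈ σ.1) {P : PrimeDivisor (F.toricVariety k)} (hP : P.1 ∈ F.affineOpen k σ) :
    principalDivisor (F.character k (b.coord i)) P = F.toricDivisor k ρ P := by
  classical
  rw [principalDivisor_coord b hb (hρ ▸ hi) hP, SmoothFan.toricDivisor]
  have := (closure_eq_closure_orbit_iff b hb hρ hi hP).1
  by_cases h : (F.character k (b.coord i))⁻¹ ∈ localSubring P.1 <;> simp [h, this]

/-- The divisor of a ray which is not a ray of `σ` does not meet `U_σ`. -/
lemma toricDivisor_eq_zero {σ : F.Cone} {ρ : F.Ray} (hρ : ρ.1 ∉ σ.1)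
    {P : PrimeDivisor (F.toricVariety k)} (hP : P.1 ∈ F.affineOpen k σ) :
    F.toricDivisor k ρ P = 0 := by
  classical
  rw [SmoothFan.toricDivisor, if_neg]
  intro hcl
  have hPcl : P.1 ∈ closure (F.orbit k ρ.toCone) := hcl ▸ subset_closure rfl
  obtain ⟨y, hyσ, hyo⟩ := mem_closure_iff.1 hPcl _ (F.affineOpen k σ).isOpen hP
  obtain ⟨hyρ, hy⟩ := mem_orbit_iff.1 hyo
  obtain ⟨l, hlρ, hlσ, hyl⟩ := exists_common_face F k hyρ hyσ
  obtain ⟨j, hj⟩ := subset_range_coneBasis ρ.toCone (Finset.mem_singleton_self ρ.1)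
  refine hy ((F.coneBasis ρ.toCone).coord j) (by rw [← hj]; simp) ?_
  rw [← character_neg]
  refine character_mem_localSubring hyl fun v hv => ?_
  have hvρ : v = ρ.1 := Finset.mem_singleton.1 (hlρ hv)
  exact absurd (hvρ ▸ hlσ hv) hρ

lemma toricDivisor_nonneg (ρ : F.Ray) (P : PrimeDivisor (F.toricVariety k)) :
    0 ≤ F.toricDivisor k ρ P := by
  unfold SmoothFan.toricDivisor
  split_ifs
  · exact zero_le_one
  · exact le_rfl

lemma toricDivisor_le_one (ρ : F.Ray) (P : PrimeDivisor (F.toricVariety k)) :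
    F.toricDivisor k ρ P ≤ 1 := by
  unfold SmoothFan.toricDivisor
  split_ifs
  · exact le_rfl
  · exact zero_le_one

/-- A prime divisor which does not meet the torus is the divisor of a ray. -/
lemma mem_affineOpen_zeroCone_or (P : PrimeDivisor (F.toricVariety k)) :
    P.1 ∈ F.affineOpen k F.zeroCone ∨
      ∃ ρ : F.Ray, P.1 ∈ F.affineOpen k ρ.toCone ∧ F.toricDivisor k ρ P = 1 := by
  classical
  obtain ⟨σ, hσ⟩ := exists_mem_affineOpen F k P.1
  have hb := subset_range_coneBasis σ
  by_cases h : ∃ i, F.coneBasis σ i ∈ σ.1 ∧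
      (F.character k ((F.coneBasis σ).coord i))⁻¹ ∉ localSubring P.1
  · obtain ⟨i, hi, hinv⟩ := h
    let ρ : F.Ray := ⟨F.coneBasis σ i, F.face_mem _ σ.2 _ (Finset.singleton_subset_iff.2 hi)⟩
    obtain ⟨h1, h2⟩ := closure_eq_closure_orbit_iff (F.coneBasis σ) hb (ρ := ρ) rfl hi hσ
    exact .inr ⟨ρ, h2 hinv, if_pos (h1.2 hinv)⟩
  · push Not at h
    left
    have h0 : F.zeroCone ≤ σ := Finset.empty_subset σ.1
    have hval : ∀ j, (∑ i with F.coneBasis σ i ∈ σ.1, (F.coneBasis σ).coord i)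
        (F.coneBasis σ j) = if F.coneBasis σ j ∈ σ.1 then 1 else 0 := by
      intro j
      simp [Finsupp.single_apply, Finset.sum_ite_eq]
    refine mem_affineOpen_of_face h0 (m := ∑ i with F.coneBasis σ i ∈ σ.1, (F.coneBasis σ).coord i)
      ?_ ?_ hσ ?_
    · exact sum_mem fun i _ => coord_mem_dualMonoid _ hb i
    · intro v hv
      obtain ⟨j, rfl⟩ := hb hv
      rw [hval, if_pos hv]
      simp [SmoothFan.zeroCone]
    · have hsum : ∀ t : Finset (Fin (Module.finrank ℤ N)),
          (∀ i ∈ t, F.coneBasis σ i ∈ σ.1) →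
          (F.character k (∑ i ∈ t, (F.coneBasis σ).coord i))⁻¹ ∈ localSubring P.1 := by
        intro t
        induction t using Finset.induction_on with
        | empty =>
          intro _
          rw [Finset.sum_empty, character_zero, inv_one]
          exact one_mem _
        | insert i t hi ih =>
          intro ht
          rw [Finset.sum_insert hi, character_add, mul_inv]
          exact mul_mem (h i (ht i (Finset.mem_insert_self i t)))
            (ih fun j hj => ht j (Finset.mem_insert_of_mem hj))
      exact hsum _ fun i hi => (Finset.mem_filter.1 hi).2

end Orbits

/-! ### The decoration in terms of dual generators -/

section Formula

variable {N : Type u} [AddCommGroup N] {F : SmoothFan N} {k : Type u} [Field k]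

lemma SmoothFan.MaxCone.subset_range_basis (σ : F.MaxCone) : (σ.1.1 : Set N) ⊆ Set.range σ.basis :=
  fun v hv => ⟨⟨v, hv⟩, σ.basis_apply ⟨v, hv⟩⟩

/-- The local formula for the Weil decoration in the chart of a full-dimensional cone. -/
lemma tangentDecoration_logDerivation (a : (F.toricVariety k).functionField ⊗[ℤ] N)
    (σ : F.MaxCone) {P : PrimeDivisor (F.toricVariety k)} (hP : P.1 ∈ F.affineOpen k σ.1) :
    tangentDecoration F k (F.logDerivation k a) P = Finset.univ.inf fun ρ : σ.1.1 =>
      principalDivisor (pairing _ (σ.dualGenerator ρ) a) P + F.toricDivisor k (σ.ray ρ) P := by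
  rw [tangentDecoration_eq σ.basis σ.subset_range_basis hP, coordOrder]
  refine Finset.inf_congr rfl fun ρ _ => ?_
  rw [logDerivation_character, principalDivisor_mul,
    principalDivisor_coord_eq_toricDivisor σ.basis σ.subset_range_basis
      (ρ := σ.ray ρ) (σ.basis_apply ρ) ρ.2 hP]
  rfl

lemma principalDivisor_neg {X : Scheme.{u}} [IsIntegral X] [IsLocallyNoetherian X]
    (hX : HasFactorialCover X) (f : X.functionField) (P : PrimeDivisor X) :
    principalDivisor (-f) P = principalDivisor f P := by
  have h0 : 0 ≤ principalDivisor (-1 : X.functionField) P :=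
    (principalDivisor_nonneg_iff hX).2 (neg_mem (one_mem _))
  have h : ∀ g : X.functionField, principalDivisor g P ≤ principalDivisor (-g) P := fun g => by
    rw [← neg_one_mul, principalDivisor_mul]
    exact le_add_of_nonneg_left h0
  exact le_antisymm (by simpa using h (-f)) (h f)

/-- Pole orders of the values `⟨m, a⟩` are bounded by those at the elements of a basis of `M`. -/
lemma le_principalDivisor_pairing_add {X : Scheme.{u}} [IsIntegral X] [IsLocallyNoetherian X]
    (hX : HasFactorialCover X) {P : PrimeDivisor X} {ι : Type*} [Fintype ι]
    (b : Module.Basis ι ℤ N) {c d : WithTop ℤ} {a : X.functionField ⊗[ℤ] N}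
    (h : ∀ i, c ≤ principalDivisor (pairing X.functionField (b.coord i) a) P + d)
    (m : CharLattice N) :
    c ≤ principalDivisor (pairing X.functionField m a) P + d := by
  let S : AddSubgroup X.functionField :=
    { carrier := {f | c ≤ principalDivisor f P + d}
      zero_mem' := by simp [principalDivisor_zero]
      add_mem' := fun {f g} hf hg => by
        rw [Set.mem_ofPred_eq] at hf hg
        refine (le_min hf hg).trans ?_
        rw [min_add_add_right]
        exact add_le_add_left (principalDivisor_add hX f g P) d
      neg_mem' := fun {f} hf => by
        rw [Set.mem_ofPred_eq, principalDivisor_neg hX]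
        exact hf }
  let ev : CharLattice N →+ X.functionField :=
    { toFun := fun m => pairing X.functionField m a
      map_zero' := by simp [pairing]
      map_add' := fun m m' => pairing_add _ _ _ _ }
  have hev : ev m = ∑ i, m (b i) • ev (b.coord i) := by
    conv_lhs => rw [eq_sum_dualCoord b m]
    rw [map_sum]
    simp_rw [map_zsmul]
  have hS : ev m ∈ S := by
    rw [hev]
    exact sum_mem fun i _ => zsmul_mem (h i) _
  exact hS

/-- A smooth fan whose rays span and lie in full-dimensional cones has a full-dimensional cone. -/
lemma exists_maxCone [Module.Free ℤ N] [Module.Finite ℤ N] (hF : F.RaysSpan)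
    (hmax : ∀ ρ : F.Ray, ∃ σ : F.MaxCone, ρ.1 ∈ σ.1.1) : Nonempty F.MaxCone := by
  by_cases hne : Nonempty F.Ray
  · obtain ⟨ρ⟩ := hne
    exact ⟨(hmax ρ).choose⟩
  · rw [not_nonempty_iff] at hne
    refine ⟨⟨F.zeroCone, ?_⟩⟩
    rw [SmoothFan.RaysSpan, Set.range_eq_empty, Submodule.span_empty] at hF
    have h1 : Module.finrank ℝ (ℝ ⊗[ℤ] N) = 0 := by
      rw [← finrank_top ℝ (ℝ ⊗[ℤ] N), ← hF, finrank_bot]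
    rw [Module.finrank_baseChange] at h1
    rw [h1]
    rfl

end Formula

end Toric

theorem mainTheorem5 {k : Type u} [Field k] [IsAlgClosed k] [CharZero k]
    {N : Type u} [AddCommGroup N] [Module.Free ℤ N] [Module.Finite ℤ N]
    (F : Toric.SmoothFan N) (hF : F.RaysSpan) :
    (∃! W, Toric.IsWeilDecoration (Toric.tangentSheaf k (F.toricVariety k)) W) ∧
    ∀ W, Toric.IsWeilDecoration (Toric.tangentSheaf k (F.toricVariety k)) W →
      ∀ a : (F.toricVariety k).functionField ⊗[ℤ] N,
        ((∀ ρ : F.Ray, ∃ σ : F.MaxCone, ρ.1 ∈ σ.1.1) →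
          W (F.logDerivation k a) =
            Finset.univ.inf fun σ : F.MaxCone => Finset.univ.inf fun ρ : σ.1.1 =>
              Toric.principalDivisor (Toric.pairing _ (σ.dualGenerator ρ) a) +
                F.toricDivisor k (σ.ray ρ) + ∑ ρ' ∈ σ.otherRays, F.toricDivisor k ρ') ∧
        ∀ σ : F.MaxCone, ∀ P : Toric.PrimeDivisor (F.toricVariety k),
          P.1 ∈ F.affineOpen k σ.1 →
          W (F.logDerivation k a) P = Finset.univ.inf fun ρ : σ.1.1 =>
            Toric.principalDivisor (Toric.pairing _ (σ.dualGenerator ρ) a) P +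
              F.toricDivisor k (σ.ray ρ) P := by
  classical
  have hX := Toric.hasFactorialCover_toricVariety F k
  have hW := Toric.isWeilDecoration_tangentDecoration F k
  refine ⟨⟨_, hW, fun W' hW' => hW'.unique hX hW⟩, fun W hW' a => ?_⟩
  obtain rfl := hW'.unique hX hW
  refine ⟨fun hmax => ?_, fun σ P hP => Toric.tangentDecoration_logDerivation a σ hP⟩
  funext P
  have hother_nonneg : ∀ σ : F.MaxCone, 0 ≤ ∑ ρ' ∈ σ.otherRays, F.toricDivisor k ρ' P :=
    fun σ => Finset.sum_nonneg fun ρ' _ => Toric.toricDivisor_nonneg ρ' P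
  simp only [Finset.inf_apply, Pi.add_apply, Finset.sum_apply]
  apply le_antisymm
  · refine Finset.le_inf fun σ _ => Finset.le_inf fun ρ _ => ?_
    by_cases hP : P.1 ∈ F.affineOpen k σ.1
    · rw [Toric.tangentDecoration_logDerivation a σ hP]
      exact (Finset.inf_le (Finset.mem_univ ρ)).trans (le_add_of_nonneg_right (hother_nonneg σ))
    -- A prime divisor which does not meet `U_σ` is the divisor of a ray `ρ₀` outside `σ`.
    have h0 : F.zeroCone ≤ σ.1 := Finset.empty_subset σ.1.1
    obtain ⟨ρ₀, hPρ, hρ₀⟩ := (Toric.mem_affineOpen_zeroCone_or P).resolve_left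
      fun h => hP (Toric.affineOpen_mono F k h0 h)
    have hρσ : ρ₀.1 ∉ σ.1.1 := fun h =>
      hP (Toric.affineOpen_mono F k (τ := ρ₀.toCone) (Finset.singleton_subset_iff.2 h) hPρ)
    obtain ⟨σ₀, hσ₀⟩ := hmax ρ₀
    have hPσ₀ : P.1 ∈ F.affineOpen k σ₀.1 :=
      Toric.affineOpen_mono F k (τ := ρ₀.toCone) (Finset.singleton_subset_iff.2 hσ₀) hPρ
    have hone : 1 ≤ ∑ ρ' ∈ σ.otherRays, F.toricDivisor k ρ' P := by
      rw [← hρ₀]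
      exact Finset.single_le_sum (f := fun ρ' => F.toricDivisor k ρ' P)
        (fun ρ' _ => Toric.toricDivisor_nonneg ρ' P)
        (Finset.mem_filter.2 ⟨Finset.mem_univ ρ₀, hρσ⟩)
    -- The dual generators of `σ` are integral combinations of those of `σ₀`.
    have hle : Toric.tangentDecoration F k (F.logDerivation k a) P ≤
        Toric.principalDivisor (Toric.pairing _ (σ.dualGenerator ρ) a) P + 1 := by
      refine Toric.le_principalDivisor_pairing_add hX σ₀.basis (fun i => ?_) _
      rw [Toric.tangentDecoration_logDerivation a σ₀ hPσ₀]
      exact (Finset.inf_le (Finset.mem_univ i)).trans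
        (add_le_add_right (Toric.toricDivisor_le_one _ P) _)
    refine hle.trans (add_le_add ?_ hone)
    exact le_add_of_nonneg_right (Toric.toricDivisor_nonneg _ P)
  · obtain ⟨σ, hP⟩ : ∃ σ : F.MaxCone, P.1 ∈ F.affineOpen k σ.1 := by
      rcases Toric.mem_affineOpen_zeroCone_or P with h | ⟨ρ₀, hPρ, -⟩
      · obtain ⟨σ⟩ := Toric.exists_maxCone hF hmax
        have h0 : F.zeroCone ≤ σ.1 := Finset.empty_subset σ.1.1
        exact ⟨σ, Toric.affineOpen_mono F k h0 h⟩
      · obtain ⟨σ₀, hσ₀⟩ := hmax ρ₀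
        exact ⟨σ₀, Toric.affineOpen_mono F k (τ := ρ₀.toCone)
          (Finset.singleton_subset_iff.2 hσ₀) hPρ⟩
    refine (Finset.inf_le (Finset.mem_univ σ)).trans ?_
    rw [Toric.tangentDecoration_logDerivation a σ hP]
    have hzero : ∑ ρ' ∈ σ.otherRays, F.toricDivisor k ρ' P = 0 :=
      Finset.sum_eq_zero fun ρ' hρ' =>
        Toric.toricDivisor_eq_zero (Finset.mem_filter.1 hρ').2 hP
    simp [hzero]
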